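/- A \emph{conjunctive query} $Q$ is a non-empty finite conjunction of atoms $r(u_1,\dots,u_\rho)$, where $r$ is a relation symbol of arity $\rho$ and each $u_i$ is a variable or a constant. The hypergraph $\mathcal H_A$ of a finite collection $A$ of atoms has as nodes the variables occurring in $A$ and, for each atom of $A$, a hyperedge consisting of the variables of that atom; let $\mathcal H_Q$ be the hypergraph of the atoms of $Q$. For hypergraphs, $\mathcal H_1\le\mathcal H_2$ means that every hyperedge of $\mathcal H_1$ is contained in some hyperedge of $\mathcal H_2$. A finite hypergraph is \emph{acyclic} if it has a join tree, i.e. a tree whose vertices are its hyperedges such that any node occurring in two hyperedges occurs in every hyperedge on the path linking them. A \emph{tree projection} of $\mathcal H_1$ with respect to $\mathcal H_2$ is an acyclic hypergraph $\mathcal H_a$ with $\mathcal H_1\le\mathcal H_a\le\mathcal H_2$. A \emph{generalized hypertree decomposition} of a hypergraph $\mathcal H$ is a triple $\langle T,\chi,\lambda\rangle$, where $T$ is a finite rooted tree and each vertex $p$ of $T$ is labelled with a set $\chi(p)$ of nodes and a set $\lambda(p)$ of hyperedges of $\mathcal H$, such that: every hyperedge is contained in some $\chi(p)$; for every node $Y$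 the set $\{p : Y\in\chi(p)\}$ induces a connected subtree of $T$; and $\chi(p)\subseteq\bigcup\lambda(p)$ for every $p$. Its width is $\max_p|\lambda(p)|$. A parameterized problem is \emph{fixed-parameter tractable} if there are an algorithm, a computable function $f$ and a constant $d$ such that the algorithm solves every instance of size $n$ and parameter $k$ in time at most $f(k)\,n^{d}$. (Running times are those of a fixed program of a deterministic machine model polynomially equivalent to Turing machines, and instances are encoded in the usual way, with names in binary.) \textbf{Theorem.} The following problem is fixed-parameter tractable: given a conjunctive query $Q$ and a finite collection $\mathcal V$ of atoms (views), compute a tree projection of $\mathcal H_Q$ with respect to $\mathcal H_{\mathcal V}$, or report that there is none; the parameter is the maximum arity of the relations occurring in $(Q,\mathcal V)$. \textbf{Corollary.} For every fixed integer $w\ge 1$, the following problem is fixed-parameter tractable: given a conjunctive query $Q$, compute a generalized hypertree decomposition of $\mathcal H_Q$ of width at most $w$, or report that there is none; the parameter is the maximum arity of the atoms of $Q$. -/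

import Mathlib

namespace TreeProj

/-! ### Model of computation

Structured `while` programs over binary trees (the textbook `WHILE` language of Jones). There are
finitely many program variables, each holding a binary tree; a program has a fixed text and runs on
inputs of arbitrary size. Every operation is charged the full size of the trees that it produces
(nothing is shared for free), so running times agree, up to a polynomial, with those of multi-tape
Turing machines, in both directions, and outputs are never larger than the running time. -/

/-- The data values: binary trees without labels. -/
inductive BTree : Type
  | leaf : BTree
  | pair : BTree → BTree → BTree
  deriving DecidableEq

/-- The number of nodes of a tree. -/
def BTree.size : BTree → ℕ
  | .leaf => 1
  | .pair a b => a.size + b.size + 1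

/-- Left component; `leaf` for a leaf. -/
def BTree.hd : BTree → BTree
  | .leaf => .leaf
  | .pair a _ => a

/-- Right component; `leaf` for a leaf. -/
def BTree.tl : BTree → BTree
  | .leaf => .leaf
  | .pair _ b => b

/-- Contents of the program variables. -/
abbrev Store : Type := ℕ → BTree

/-- Expressions: program variables, constants, pairing, projections and an equality test. -/
inductive Expr : Type
  | var : ℕ → Expr
  | const : BTree → Expr
  | pair : Expr → Expr → Expr
  | hd : Expr → Expr
  | tl : Expr → Expr
  | isEq : Expr → Expr → Expr

/-- The value of an expression. Truth is `pair leaf leaf`, falsity is `leaf`. -/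
def Expr.eval (s : Store) : Expr → BTree
  | .var i => s i
  | .const t => t
  | .pair e₁ e₂ => .pair (e₁.eval s) (e₂.eval s)
  | .hd e => (e.eval s).hd
  | .tl e => (e.eval s).tl
  | .isEq e₁ e₂ => if e₁.eval s = e₂.eval s then .pair .leaf .leaf else .leaf

/-- The cost of evaluating an expression: every subexpression costs one plus the size of its
value. -/
def Expr.cost (s : Store) : Expr → ℕ
  | .var i => 1 + (s i).size
  | .const t => 1 + t.size
  | .pair e₁ e₂ => e₁.cost s + e₂.cost s + (1 + ((Expr.pair e₁ e₂).eval s).size)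
  | .hd e => e.cost s + (1 + ((Expr.hd e).eval s).size)
  | .tl e => e.cost s + (1 + ((Expr.tl e).eval s).size)
  | .isEq e₁ e₂ => e₁.cost s + e₂.cost s + (1 + ((Expr.isEq e₁ e₂).eval s).size)

/-- Programs. -/
inductive Prog : Type
  | skip : Prog
  | assign : ℕ → Expr → Prog
  | seq : Prog → Prog → Prog
  | ite : Expr → Prog → Prog → Prog
  | loop : Expr → Prog → Prog

/-- `Runs p s s' t`: started on the store `s`, the program `p` halts with the store `s'` after time
exactly `t`. In a conditional or a loop, every value but `leaf` counts as true; `loop e p` is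
"while `e` do `p`". -/
inductive Runs : Prog → Store → Store → ℕ → Prop
  | skip (s : Store) : Runs .skip s s 1
  | assign (i : ℕ) (e : Expr) (s : Store) :
      Runs (.assign i e) s (Function.update s i (e.eval s)) (e.cost s + 1)
  | seq {p q : Prog} {s₁ s₂ s₃ : Store} {t₁ t₂ : ℕ} :
      Runs p s₁ s₂ t₁ → Runs q s₂ s₃ t₂ → Runs (.seq p q) s₁ s₃ (t₁ + t₂ + 1)
  | iteTrue {e : Expr} {p q : Prog} {s s' : Store} {t : ℕ} :
      e.eval s ≠ .leaf → Runs p s s' t → Runs (.ite e p q) s s' (e.cost s + t + 1)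
  | iteFalse {e : Expr} {p q : Prog} {s s' : Store} {t : ℕ} :
      e.eval s = .leaf → Runs q s s' t → Runs (.ite e p q) s s' (e.cost s + t + 1)
  | loopStop {e : Expr} {p : Prog} {s : Store} :
      e.eval s = .leaf → Runs (.loop e p) s s (e.cost s + 1)
  | loopStep {e : Expr} {p : Prog} {s₁ s₂ s₃ : Store} {t₁ t₂ : ℕ} :
      e.eval s₁ ≠ .leaf → Runs p s₁ s₂ t₁ → Runs (.loop e p) s₂ s₃ t₂ →
      Runs (.loop e p) s₁ s₃ (e.cost s₁ + t₁ + t₂ + 1)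

/-- The input is placed in variable `0`; all other variables hold `leaf`. -/
def inputStore (x : BTree) : Store := fun i => if i = 0 then x else .leaf

/-- On input `x`, the program `p` halts within time `T` with output `y` (in variable `0`). -/
def OutputsWithin (p : Prog) (x y : BTree) (T : ℕ) : Prop :=
  ∃ (s : Store) (t : ℕ), Runs p (inputStore x) s t ∧ s 0 = y ∧ t ≤ T

/-! ### Encodings -/

/-- A list is encoded as a right comb. -/
def encList {α : Type} (enc : α → BTree) : List α → BTree
  | [] => .leaf
  | a :: l => .pair (enc a) (encList enc l)

def encBool : Bool → BTree
  | false => .leaf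
  | true => .pair .leaf .leaf

/-- Natural numbers are encoded in binary, least significant bit first. -/
def encNat (n : ℕ) : BTree := encList encBool n.bits

/-! ### Parameterized search problems -/

/-- A parameterized search problem. Instances have one encoding each; a solution may have several
encodings (for instance, a set may be listed in any order). -/
structure ParamProblem where
  Instance : Type
  Solution : Type
  param : Instance → ℕ
  IsSolution : Instance → Solution → Prop
  encInstance : Instance → BTree
  EncodesSolution : BTree → Solution → Prop

/-- The output `y` is a correct answer on the instance `x`: either it reports a solution, or it is
the answer "no" (`leaf`) and there is no solution. -/
def ParamProblem.CorrectAnswer (P : ParamProblem) (x : P.Instance) (y : BTree) : Prop :=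
  (∃ (z : P.Solution) (t : BTree),
      y = .pair .leaf t ∧ P.EncodesSolution t z ∧ P.IsSolution x z) ∨
    (y = .leaf ∧ ¬ ∃ z : P.Solution, P.IsSolution x z)

/-- Fixed-parameter tractability: one algorithm solves all instances in time `f k * n ^ d`, where
`k` is the parameter and `n` the size of the instance, `f` is computable and `d` is a constant. -/
def ParamProblem.FixedParameterTractable (P : ParamProblem) : Prop :=
  ∃ (p : Prog) (f : ℕ → ℕ) (d : ℕ), Computable f ∧
    ∀ x : P.Instance, ∃ y : BTree,
      P.CorrectAnswer x y ∧
      OutputsWithin p (P.encInstance x) y (f (P.param x) * (P.encInstance x).size ^ d)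

/-! ### Hypergraphs, acyclicity and tree projections -/

/-- Each hyperedge of `H₁` is contained in at least one hyperedge of `H₂`. -/
def Covered (H₁ H₂ : Hypergraph ℕ) : Prop :=
  ∀ h₁ ∈ H₁.edgeSet, ∃ h₂ ∈ H₂.edgeSet, h₁ ⊆ h₂

/-- A join tree: a tree on the hyperedges such that a node that occurs in two hyperedges occurs in
every hyperedge on the path linking them. -/
def IsJoinTree (H : Hypergraph ℕ) (T : SimpleGraph H.edgeSet) : Prop :=
  T.IsTree ∧
    ∀ (h₁ h₂ : H.edgeSet) (p : T.Walk h₁ h₂), p.IsPath →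
      ∀ X : ℕ, X ∈ h₁.1 → X ∈ h₂.1 → ∀ h ∈ p.support, X ∈ h.1

/-- (Alpha-)acyclicity. -/
def IsAcyclicHypergraph (H : Hypergraph ℕ) : Prop :=
  ∃ T : SimpleGraph H.edgeSet, IsJoinTree H T

/-- `H` is a tree projection of `H₁` with respect to `H₂`. -/
def IsTreeProjection (H₁ H₂ H : Hypergraph ℕ) : Prop :=
  H.vertexSet.Finite ∧ IsAcyclicHypergraph H ∧ Covered H₁ H ∧ Covered H H₂

/-! ### Conjunctive queries and views -/

/-- A term is a variable or a constant. -/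
inductive Term : Type
  | var : ℕ → Term
  | const : ℕ → Term

/-- An atom `r(u₁, …, u_ρ)`. -/
structure Atom where
  rel : ℕ
  terms : List Term

/-- The arity of the relation of an atom. -/
def Atom.arity (a : Atom) : ℕ := a.terms.length

/-- The set of variables of an atom. -/
def Atom.vars (a : Atom) : Set ℕ := {X | Term.var X ∈ a.terms}

/-- A conjunctive query: a non-empty finite conjunction of atoms. -/
structure ConjQuery where
  atoms : List Atom
  nonempty : atoms ≠ []

/-- The hypergraph of a finite collection of atoms: the nodes are the variables that occur in it,
and there is one hyperedge for the set of variables of each atom. -/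
def hypergraphOf (A : List Atom) : Hypergraph ℕ where
  vertexSet := {X | ∃ a ∈ A, X ∈ a.vars}
  edgeSet := {h | ∃ a ∈ A, h = a.vars}
  subset_vertexSet_of_mem_edgeSet' := by
    rintro h ⟨a, ha, rfl⟩ X hX
    exact ⟨a, ha, hX⟩

/-- The maximum arity of a collection of atoms. -/
def maxArity (A : List Atom) : ℕ := (A.map Atom.arity).foldr max 0

def encTerm : Term → BTree
  | .var X => .pair (encBool false) (encNat X)
  | .const c => .pair (encBool true) (encNat c)

def encAtom (a : Atom) : BTree := .pair (encNat a.rel) (encList encTerm a.terms)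

def encAtoms (A : List Atom) : BTree := encList encAtom A

/-! ### Computing tree projections -/

/-- `t` encodes the finite hypergraph `H` as the list of its nodes and the list of its hyperedges,
each a list of nodes. -/
def EncodesHypergraph (t : BTree) (H : Hypergraph ℕ) : Prop :=
  ∃ (ns : List ℕ) (es : List (List ℕ)),
    H.vertexSet = {X | X ∈ ns} ∧ H.edgeSet = {h | ∃ e ∈ es, h = {X | X ∈ e}} ∧
    t = .pair (encList encNat ns) (encList (encList encNat) es)

/-- Given a conjunctive query `Q` and a collection `V` of views, compute a tree projection of the
hypergraph of `Q` with respect to the hypergraph of `V`, or report that there is none. The parameter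
is the maximum arity of the relations that occur in `Q` and `V`. -/
def treeProjectionProblem : ParamProblem where
  Instance := ConjQuery × List Atom
  Solution := Hypergraph ℕ
  param x := maxArity (x.1.atoms ++ x.2)
  IsSolution x H := IsTreeProjection (hypergraphOf x.1.atoms) (hypergraphOf x.2) H
  encInstance x := .pair (encAtoms x.1.atoms) (encAtoms x.2)
  EncodesSolution := EncodesHypergraph

/-! ### Computing generalized hypertree decompositions -/

/-- A labelled rooted graph `⟨T, χ, lam⟩` on the vertices `0, …, N - 1`. -/
structure Hypertree where
  N : ℕ
  T : SimpleGraph (Fin N)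
  root : Fin N
  χ : Fin N → Set ℕ
  lam : Fin N → Set (Set ℕ)

/-- `D` is a generalized hypertree decomposition of `H`. -/
structure IsGHD (H : Hypergraph ℕ) (D : Hypertree) : Prop where
  isTree : D.T.IsTree
  χ_subset : ∀ p, D.χ p ⊆ H.vertexSet
  lam_subset : ∀ p, D.lam p ⊆ H.edgeSet
  edge_covered : ∀ h ∈ H.edgeSet, ∃ p, h ⊆ D.χ p
  connected : ∀ Y ∈ H.vertexSet, (D.T.induce {p | Y ∈ D.χ p}).Preconnected
  χ_subset_lam : ∀ p, D.χ p ⊆ ⋃₀ D.lam p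

/-- The width of `D`, the maximum of `|lam p|`, is at most `w`. -/
def Hypertree.WidthAtMost (D : Hypertree) (w : ℕ) : Prop := ∀ p, (D.lam p).encard ≤ w

/-- The encoding of a hypertree: its root, the list of its vertex labels, in the order of the
vertices, and a list of its (tree) edges. -/
def EncodesHypertree (t : BTree) (D : Hypertree) : Prop :=
  ∃ (labels : Fin D.N → List ℕ × List (List ℕ)) (arcs : List (Fin D.N × Fin D.N)),
    (∀ p, D.χ p = {X | X ∈ (labels p).1}) ∧
    (∀ p, D.lam p = {h | ∃ e ∈ (labels p).2, h = {X | X ∈ e}}) ∧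
    D.T = SimpleGraph.fromRel (fun p q => (p, q) ∈ arcs) ∧
    t = .pair (encNat D.root.1)
      (.pair
        (encList (fun l => .pair (encList encNat l.1) (encList (encList encNat) l.2))
          (List.ofFn labels))
        (encList (fun a => .pair (encNat a.1.1) (encNat a.2.1)) arcs))

/-- Given a conjunctive query `Q`, compute a generalized hypertree decomposition of its hypergraph
of width at most `w`, or report that there is none. The parameter is the maximum arity of the
atoms of `Q`. -/
def ghdProblem (w : ℕ) : ParamProblem where
  Instance := ConjQuery
  Solution := Hypertree
  param Q := maxArity Q.atoms
  IsSolution Q D := IsGHD (hypergraphOf Q.atoms) D ∧ D.WidthAtMost w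
  encInstance Q := encAtoms Q.atoms
  EncodesSolution := EncodesHypertree

end TreeProj

/-! A tree projection exists exactly when the hyperedges of the query have a tree decomposition each
of whose bags lies inside a view. If the arities are at most `k`, the views have at most `2 ^ k`
subsets each, and all of them can be listed (`subBags`, `TimeIn.subBags`). This is the only
exponential step. It remains to find, in polynomial time, a tree decomposition with bags from a
given list `BB`.

The search works with components `C` of complements of bags. A good bag for `C` contains the
boundary of `C`, lies in `C` together with its boundary, meets `C`, and leaves inside `C` only
components that are still listed. Discarding components without a good bag until nothing changes
gives `solvable`, a fixed point of `prune`. No induction on the size of components is needed: every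
good bag covers a new vertex, so a greedy construction that keeps choosing good bags must stop.

Soundness: the greedy construction maintains that the boundary of every uncovered component lies in
a single bag already chosen (`IsPartial.cons`). Hence the bags have the running intersection
property, and joining each bag to an earlier one that contains its old vertices gives a tree. Each
bag has a new vertex, so the bags are distinct hyperedges and this tree is a join tree
(`RunningIntersection.isAcyclicHypergraph`).

Completeness: order the bags of a given tree decomposition by removing leaves
(`exists_bagSequence`). Call `C` a block if its boundary vertices all appear earlier in this order
than its own vertices. Cutting the first bag that meets a block down to the block and its boundary
gives a good bag, and the pieces it leaves are again blocks (`BagSequence.IsBlock.exists_bag`). So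
blocks are never discarded; the connected components are blocks, and the greedy construction
finishes.

For hypertree decompositions of width `w`, the views are the unions of at most `w` hyperedges,
labelled with those hyperedges. There are polynomially many for fixed `w`, each with at most `w * k`
vertices.

Running times are obtained from a small calculus of polynomial-time functions whose main tool is the
fold over a list (`timeIn_foldl`). -/

namespace TreeProj

/-! ### Polynomial bounds -/

/-- `P` is bounded by a polynomial. -/
def PolyBounded (P : ℕ → ℕ) : Prop := ∃ c, ∀ n, P n ≤ (n + 2) ^ c

namespace PolyBounded

theorem const (k : ℕ) : PolyBounded (fun _ => k) :=
  ⟨k, fun n => (Nat.lt_two_pow_self (n := k)).le.trans (Nat.pow_le_pow_left (by omega) k)⟩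

theorem id : PolyBounded (fun n => n) := ⟨1, fun n => by simp⟩

theorem add {P Q : ℕ → ℕ} (hP : PolyBounded P) (hQ : PolyBounded Q) :
    PolyBounded (fun n => P n + Q n) := by
  obtain ⟨a, ha⟩ := hP
  obtain ⟨b, hb⟩ := hQ
  refine ⟨a + b + 1, fun n => ?_⟩
  have h1 : (n + 2) ^ a ≤ (n + 2) ^ (a + b) := Nat.pow_le_pow_right (by omega) (by omega)
  have h2 : (n + 2) ^ b ≤ (n + 2) ^ (a + b) := Nat.pow_le_pow_right (by omega) (by omega)
  have := ha n
  have := hb n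
  calc P n + Q n ≤ (n + 2) ^ (a + b) * 2 := by omega
    _ ≤ (n + 2) ^ (a + b) * (n + 2) := Nat.mul_le_mul_left _ (by omega)
    _ = _ := (pow_succ _ _).symm

theorem mul {P Q : ℕ → ℕ} (hP : PolyBounded P) (hQ : PolyBounded Q) :
    PolyBounded (fun n => P n * Q n) := by
  obtain ⟨a, ha⟩ := hP
  obtain ⟨b, hb⟩ := hQ
  refine ⟨a + b, fun n => ?_⟩
  rw [pow_add]
  exact Nat.mul_le_mul (ha n) (hb n)

theorem pow {P : ℕ → ℕ} (hP : PolyBounded P) (c : ℕ) : PolyBounded (fun n => P n ^ c) := by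
  induction c with
  | zero => simpa using const 1
  | succ c ih => simpa [pow_succ] using ih.mul hP

theorem exp (c : ℕ) : PolyBounded (fun n => (n + 2) ^ c) := (id.add (const 2)).pow c

end PolyBounded

/-! ### Encodable types -/

/-- Types whose elements are encoded as binary trees. -/
class Enc (α : Type) where
  enc : α → BTree

open Enc (enc)

instance : Enc ℕ := ⟨encNat⟩
instance : Enc Bool := ⟨encBool⟩
instance {α : Type} [Enc α] : Enc (List α) := ⟨encList enc⟩
instance {α β : Type} [Enc α] [Enc β] : Enc (α × β) := ⟨fun x => .pair (enc x.1) (enc x.2)⟩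
instance {α : Type} [Enc α] : Enc (Option α) :=
  ⟨fun o => o.elim .leaf fun a => .pair .leaf (enc a)⟩
instance : Enc Term := ⟨encTerm⟩
instance : Enc Atom := ⟨encAtom⟩
instance : Enc ConjQuery := ⟨fun Q => encAtoms Q.atoms⟩

/-- The size of the encoding. -/
def sz {α : Type} [Enc α] (a : α) : ℕ := (enc a).size

section

variable {α β γ δ : Type} [Enc α] [Enc β] [Enc γ] [Enc δ]

theorem BTree.size_pos (t : BTree) : 1 ≤ t.size := by cases t <;> simp [BTree.size]

theorem sz_pos (a : α) : 1 ≤ sz a := BTree.size_pos _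

@[simp] theorem sz_pair (a : α) (b : β) : sz (a, b) = sz a + sz b + 1 := rfl
@[simp] theorem sz_nil : sz ([] : List α) = 1 := rfl
@[simp] theorem sz_cons (a : α) (l : List α) : sz (a :: l) = sz a + sz l + 1 := rfl

theorem sz_bool_le (a : Bool) : sz a ≤ 3 := by
  cases a <;> simp [sz, enc, encBool, BTree.size]

theorem sz_append (l l' : List α) : sz (l ++ l') + 1 = sz l + sz l' := by
  induction l with
  | nil => simp [add_comm]
  | cons a l ih => simp only [List.cons_append, sz_cons]; omega

theorem length_lt_sz (l : List α) : l.length < sz l := by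
  induction l with
  | nil => simp
  | cons a l ih => simp; omega

theorem sz_le_of_mem {a : α} {l : List α} (h : a ∈ l) : sz a < sz l := by
  induction l with
  | nil => simp at h
  | cons b l ih =>
    rcases List.mem_cons.1 h with rfl | h
    · simp only [sz_cons]; omega
    · have := ih h
      simp only [sz_cons]; omega

theorem sz_list_le {l : List α} {M : ℕ} (h : ∀ a ∈ l, sz a ≤ M) :
    sz l ≤ l.length * (M + 1) + 1 := by
  induction l with
  | nil => simp
  | cons a l ih =>
    have := ih fun b hb => h b (by simp [hb])
    have := h a (by simp)
    simp [add_mul]; omega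

theorem sz_le_of_sublist {l l' : List α} (h : l.Sublist l') : sz l ≤ sz l' := by
  induction h with
  | slnil => simp
  | cons a _ ih => simp; omega
  | cons_cons a _ ih => simp; omega

/-! ### Running programs on one variable -/

/-- Started with `x` in variable `b`, the program `p` halts within time `T` with `y` in variable
`b`, and does not change the variables below `b`. -/
def RunsAt (p : Prog) (b : ℕ) (x y : BTree) (T : ℕ) : Prop :=
  ∀ s : Store, s b = x → ∃ s' t, Runs p s s' t ∧ s' b = y ∧ (∀ i < b, s' i = s i) ∧ t ≤ T

/-- `f` is computable in time polynomial in the measure `m`. -/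
def TimeIn (m : α → ℕ) (f : α → β) : Prop :=
  ∃ c, (∀ a, sz (f a) ≤ (m a + 2) ^ c) ∧
    ∀ b, ∃ p, ∀ a, RunsAt p b (enc a) (enc (f a)) ((m a + 2) ^ c)

/-- `f` is computable in polynomial time. -/
def PolyTime (f : α → β) : Prop := TimeIn sz f

theorem RunsAt.mono {p : Prog} {b : ℕ} {x y : BTree} {T T' : ℕ} (h : RunsAt p b x y T)
    (hT : T ≤ T') : RunsAt p b x y T' := fun s hs => by
  obtain ⟨s', t, h1, h2, h3, h4⟩ := h s hs
  exact ⟨s', t, h1, h2, h3, h4.trans hT⟩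

theorem TimeIn.intro {m : α → ℕ} {f : α → β} {P : ℕ → ℕ} (hP : PolyBounded P)
    (hs : ∀ a, sz (f a) ≤ P (m a))
    (hp : ∀ b, ∃ p, ∀ a, RunsAt p b (enc a) (enc (f a)) (P (m a))) : TimeIn m f := by
  obtain ⟨c, hc⟩ := hP
  refine ⟨c, fun a => (hs a).trans (hc _), fun b => ?_⟩
  obtain ⟨p, hp⟩ := hp b
  exact ⟨p, fun a => (hp a).mono (hc _)⟩

theorem Expr.size_eval_le_cost (s : Store) (e : Expr) : (e.eval s).size ≤ e.cost s := by
  cases e <;> simp only [Expr.eval, Expr.cost] <;> omega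

/-- A function given by an expression is computable in polynomial time. -/
theorem PolyTime.of_expr {f : α → β} {P : ℕ → ℕ} (hP : PolyBounded P) (e : ℕ → Expr)
    (he : ∀ b (s : Store) a, s b = enc a →
      (e b).eval s = enc (f a) ∧ (e b).cost s ≤ P (sz a)) : PolyTime f := by
  refine TimeIn.intro (hP.add (.const 1)) (fun a => ?_) fun b => ⟨.assign b (e b), fun a s hs => ?_⟩
  · obtain ⟨h1, h2⟩ := he 0 (fun _ => enc a) a rfl
    have := Expr.size_eval_le_cost (fun _ => enc a) (e 0)
    rw [h1] at this
    exact (this.trans h2).trans (by omega)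
  · obtain ⟨h1, h2⟩ := he b s a hs
    refine ⟨_, _, Runs.assign b (e b) s, by simp [h1], fun i hi => ?_, by omega⟩
    rw [Function.update_of_ne (by omega)]

theorem TimeIn.comp {m : α → ℕ} {m' : β → ℕ} {f : α → β} {g : β → γ} (hg : TimeIn m' g)
    (hf : TimeIn m f) {Q : ℕ → ℕ} (hQ : PolyBounded Q) (h : ∀ a, m' (f a) ≤ Q (m a)) :
    TimeIn m (fun a => g (f a)) := by
  obtain ⟨c, hs, hp⟩ := hf
  obtain ⟨c', hs', hp'⟩ := hg
  have hle : ∀ a, (m' (f a) + 2) ^ c' ≤ (Q (m a) + 2) ^ c' := fun a =>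
    Nat.pow_le_pow_left (by have := h a; omega) _
  refine TimeIn.intro (P := fun n => (n + 2) ^ c + (Q n + 2) ^ c' + 1)
    (((PolyBounded.exp c).add ((hQ.add (.const 2)).pow c')).add (.const 1)) (fun a => ?_)
    fun b => ?_
  · have := (hs' (f a)).trans (hle a)
    omega
  · obtain ⟨p, hp⟩ := hp b
    obtain ⟨p', hp'⟩ := hp' b
    refine ⟨.seq p p', fun a s hs => ?_⟩
    obtain ⟨s₁, t₁, h1, h2, h3, h4⟩ := hp a s hs
    obtain ⟨s₂, t₂, h1', h2', h3', h4'⟩ := hp' (f a) s₁ h2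
    refine ⟨s₂, _, .seq h1 h1', h2', fun i hi => (h3' i hi).trans (h3 i hi), ?_⟩
    have := hle a
    omega

theorem PolyTime.comp {m : α → ℕ} {f : α → β} {g : β → γ} (hg : PolyTime g) (hf : TimeIn m f) :
    TimeIn m (fun a => g (f a)) := by
  obtain ⟨c, hs, _⟩ := id hf
  exact TimeIn.comp hg hf (PolyBounded.exp c) hs

theorem PolyTime.timeIn {m : α → ℕ} {f : α → β} (hf : PolyTime f) {Q : ℕ → ℕ}
    (hQ : PolyBounded Q) (h : ∀ a, sz a ≤ Q (m a)) : TimeIn m f := by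
  obtain ⟨c, hs, hp⟩ := hf
  have hle : ∀ a, (sz a + 2) ^ c ≤ (Q (m a) + 2) ^ c := fun a =>
    Nat.pow_le_pow_left (by have := h a; omega) _
  refine TimeIn.intro ((hQ.add (.const 2)).pow c) (fun a => (hs a).trans (hle a)) fun b => ?_
  obtain ⟨p, hp⟩ := hp b
  exact ⟨p, fun a => (hp a).mono (hle a)⟩

/-! ### Elementary polynomial-time functions. -/

namespace PolyTime

/-- A change of type that preserves encodings. -/
theorem cast {f : α → β} (h : ∀ a, enc (f a) = enc a) : PolyTime f :=
  .of_expr (PolyBounded.id.add (.const 1)) (fun b => .var b) fun b s a hs => by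
    simp only [Expr.eval, Expr.cost, hs, h, sz, true_and]; omega

theorem id : PolyTime (fun a : α => a) := cast fun _ => rfl

theorem const (y : β) : PolyTime (fun _ : α => y) :=
  .of_expr (.const (1 + sz y)) (fun _ => .const (enc y)) fun b s a _ => by
    simp [Expr.eval, Expr.cost, sz]

theorem fst' : PolyTime (fun x : α × β => x.1) :=
  .of_expr ((PolyBounded.id.add .id).add (.const 2)) (fun b => .hd (.var b)) fun b s a hs => by
    have h : s b = .pair (enc a.1) (enc a.2) := hs
    have : sz a = sz a.1 + sz a.2 + 1 := rfl
    simp only [Expr.eval, Expr.cost, h, BTree.hd, true_and, BTree.size, this]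
    simp only [sz]; omega

theorem snd' : PolyTime (fun x : α × β => x.2) :=
  .of_expr ((PolyBounded.id.add .id).add (.const 2)) (fun b => .tl (.var b)) fun b s a hs => by
    have h : s b = .pair (enc a.1) (enc a.2) := hs
    have : sz a = sz a.1 + sz a.2 + 1 := rfl
    simp only [Expr.eval, Expr.cost, h, BTree.tl, true_and, BTree.size, this]
    simp only [sz]; omega

theorem cons' : PolyTime (fun x : α × List α => x.1 :: x.2) := cast fun _ => rfl

theorem some' : PolyTime (fun x : α => some x) :=
  .of_expr ((PolyBounded.id.add .id).add (.const 6)) (fun b => .pair (.const .leaf) (.var b))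
    fun b s a hs => by
    refine ⟨by simp only [Expr.eval, hs]; rfl, ?_⟩
    simp only [Expr.eval, Expr.cost, hs, BTree.size, sz]; omega

theorem eq' {e : α → α → Bool} (he : ∀ x y, e x y = true ↔ enc x = enc y) :
    PolyTime (fun x : α × α => e x.1 x.2) :=
  .of_expr ((PolyBounded.const 10).mul (PolyBounded.id.add (.const 1)))
    (fun b => .isEq (.hd (.var b)) (.tl (.var b))) fun b s a hs => by
    have h : s b = .pair (enc a.1) (enc a.2) := hs
    have h' : sz a = sz a.1 + sz a.2 + 1 := rfl
    have h1 : (Expr.isEq (.hd (.var b)) (.tl (.var b))).eval s = enc (e a.1 a.2) := by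
      simp only [Expr.eval, h, BTree.hd, BTree.tl]
      by_cases hh : enc a.1 = enc a.2
      · rw [if_pos hh, (he _ _).2 hh]; rfl
      · rw [if_neg hh, Bool.eq_false_iff.2 (fun h => hh ((he _ _).1 h))]; rfl
    refine ⟨h1, ?_⟩
    have h3 : (enc (e a.1 a.2)).size ≤ 3 := sz_bool_le _
    simp only [Expr.cost]
    rw [h1]
    simp only [Expr.eval, h, BTree.hd, BTree.tl, BTree.size, h']
    simp only [sz]; omega

end PolyTime

/-- Programs are available at every offset `b` and leave lower variables alone: `f` is computed at
`b + 1`, and its value survives the computation of `g` at `b + 2`. The measure must dominate the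
input size because the input is copied. -/
theorem TimeIn.pair {m : α → ℕ} (hm : ∀ a, sz a ≤ m a) {f : α → β} {g : α → γ} (hf : TimeIn m f)
    (hg : TimeIn m g) : TimeIn m (fun a => (f a, g a)) := by
  obtain ⟨c, hs, hp⟩ := hf
  obtain ⟨c', hs', hp'⟩ := hg
  refine TimeIn.intro
    (P := fun n => 20 * ((n + 2) ^ c + (n + 2) ^ c' + (n + 1)))
    ((PolyBounded.const 20).mul (((PolyBounded.exp c).add (.exp c')).add (.add .id (.const 1))))
    (fun a => ?_) fun b => ?_
  · have := hs a
    have := hs' a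
    rw [sz_pair]; omega
  · obtain ⟨p, hp⟩ := hp (b + 1)
    obtain ⟨q, hq⟩ := hp' (b + 2)
    refine ⟨.seq (.assign (b + 1) (.var b)) (.seq p (.seq (.assign (b + 2) (.var b)) (.seq q
      (.assign b (.pair (.var (b + 1)) (.var (b + 2))))))), fun a s h => ?_⟩
    obtain ⟨s₂, t₂, r2, v2, k2, l2⟩ := hp a (Function.update s (b + 1) (s b)) (by simp [h])
    have hb2 : s₂ b = enc a := by
      rw [k2 b (by omega), Function.update_of_ne (by omega), h]
    obtain ⟨s₄, t₄, r4, v4, k4, l4⟩ := hq a (Function.update s₂ (b + 2) (s₂ b)) (by simp [hb2])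
    have hb4 : s₄ (b + 1) = enc (f a) := by
      rw [k4 _ (by omega), Function.update_of_ne (by omega), v2]
    refine ⟨_, _, .seq (.assign _ _ _) (.seq r2 (.seq (.assign _ _ _) (.seq r4
      (.assign _ _ _)))), ?_, fun i hi => ?_, ?_⟩
    · simp only [Function.update_self, Expr.eval, hb4, v4]; rfl
    · rw [Function.update_of_ne (by omega), k4 i (by omega), Function.update_of_ne (by omega),
        k2 i (by omega), Function.update_of_ne (by omega)]
    · have e1 := hs a
      have e2 := hs' a
      have e3 := hm a
      simp only [Expr.cost, Expr.eval, BTree.size, h, hb2, hb4, v4]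
      simp only [sz] at e1 e2 e3
      omega

namespace PolyTime

theorem pair {f : α → β} {g : α → γ} (hf : PolyTime f) (hg : PolyTime g) :
    PolyTime (fun a => (f a, g a)) := TimeIn.pair (fun _ => le_rfl) hf hg

theorem comp₂ {h : β × γ → δ} (hh : PolyTime h) {f : α → β} {g : α → γ} (hf : PolyTime f)
    (hg : PolyTime g) : PolyTime (fun a => h (f a, g a)) := hh.comp (hf.pair hg)

theorem fst {f : α → β × γ} (hf : PolyTime f) : PolyTime (fun a => (f a).1) := fst'.comp hf
theorem snd {f : α → β × γ} (hf : PolyTime f) : PolyTime (fun a => (f a).2) := snd'.comp hf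

theorem cons {f : α → β} {g : α → List β} (hf : PolyTime f) (hg : PolyTime g) :
    PolyTime (fun a => f a :: g a) := cons'.comp (hf.pair hg)

theorem ite {c : α → Bool} {f g : α → β} (hc : PolyTime c) (hf : PolyTime f) (hg : PolyTime g) :
    PolyTime (fun a => if c a then f a else g a) := by
  obtain ⟨k, hs, hp⟩ := hf
  obtain ⟨k', hs', hp'⟩ := hg
  obtain ⟨k₀, hs₀, hp₀⟩ := hc
  refine TimeIn.intro
    (P := fun n => 10 * ((n + 2) ^ k + (n + 2) ^ k' + (n + 2) ^ k₀ + (n + 1)))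
    ((PolyBounded.const 10).mul ((((PolyBounded.exp k).add (.exp k')).add (.exp k₀)).add
      (.add .id (.const 1)))) (fun a => ?_) fun b => ?_
  · have := hs a
    have := hs' a
    split <;> omega
  · obtain ⟨p, hp⟩ := hp b
    obtain ⟨q, hq⟩ := hp' b
    obtain ⟨r, hr⟩ := hp₀ (b + 1)
    refine ⟨.seq (.assign (b + 1) (.var b)) (.seq r (.ite (.var (b + 1)) p q)), fun a s h => ?_⟩
    obtain ⟨s₂, t₂, r2, v2, k2, l2⟩ := hr a (Function.update s (b + 1) (s b)) (by simp [h])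
    have hb2 : s₂ b = enc a := by
      rw [k2 b (by omega), Function.update_of_ne (by omega), h]
    have hi2 : ∀ i < b, s₂ i = s i := fun i hi => by
      rw [k2 i (by omega), Function.update_of_ne (by omega)]
    have hc3 : (s₂ (b + 1)).size ≤ 3 := by rw [v2]; exact sz_bool_le _
    have e1 : sz a = (enc a).size := rfl
    cases hca : c a with
    | true =>
      obtain ⟨s₃, t₃, r3, v3, k3, l3⟩ := hp a s₂ hb2
      refine ⟨s₃, _, .seq (.assign _ _ _) (.seq r2 (.iteTrue ?_ r3)), by simpa using v3,
        fun i hi => (k3 i hi).trans (hi2 i hi), ?_⟩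
      · simp only [Expr.eval, v2, hca]; exact BTree.noConfusion
      · simp only [Expr.cost, h]; omega
    | false =>
      obtain ⟨s₃, t₃, r3, v3, k3, l3⟩ := hq a s₂ hb2
      refine ⟨s₃, _, .seq (.assign _ _ _) (.seq r2 (.iteFalse ?_ r3)), by simpa using v3,
        fun i hi => (k3 i hi).trans (hi2 i hi), ?_⟩
      · simp only [Expr.eval, v2, hca]; rfl
      · simp only [Expr.cost, h]; omega

/-- The pairs `(a, c :: l)` and `(a, c, l)` have the same encoding, so the branch for a non-empty
list needs no rearrangement; the list is empty when the right component is a leaf. -/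
theorem list_cases' {f : α → γ} {g : α × β × List β → γ} (hf : PolyTime f) (hg : PolyTime g) :
    PolyTime (fun x : α × List β => (x.2.casesOn (f x.1) fun b l => g (x.1, b, l) : γ)) := by
  obtain ⟨k, hs, hp⟩ := hf
  obtain ⟨k', hs', hp'⟩ := hg
  have hle : ∀ {m n : ℕ} (k : ℕ), m ≤ n → (m + 2) ^ k ≤ (n + 2) ^ k := fun k h =>
    Nat.pow_le_pow_left (by omega) k
  refine TimeIn.intro
    (P := fun n => 10 * ((n + 2) ^ k + (n + 2) ^ k' + (n + 1)))
    ((PolyBounded.const 10).mul (((PolyBounded.exp k).add (.exp k')).add (.add .id (.const 1))))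
    (fun a => ?_) fun b => ?_
  · rcases a with ⟨a, _ | ⟨b, l⟩⟩
    · have := hs a
      have := hle k (show sz a ≤ sz (a, ([] : List β)) by simp; omega)
      dsimp only; omega
    · have := hs' (a, b, l)
      have := hle k' (show sz (a, b, l) ≤ sz (a, b :: l) by simp)
      dsimp only; omega
  · obtain ⟨p, hp⟩ := hp b
    obtain ⟨q, hq⟩ := hp' b
    refine ⟨.ite (.tl (.var b)) q (.seq (.assign b (.hd (.var b))) p), fun x s h => ?_⟩
    have hx : (s b).size = sz x := by rw [h]; rfl
    rcases x with ⟨a, _ | ⟨c, l⟩⟩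
    · have hh : s b = .pair (enc a) .leaf := h
      obtain ⟨s₃, t₃, r3, v3, k3, l3⟩ := hp a (Function.update s b (enc a)) (by simp)
      have := hle k (show sz a ≤ sz (a, ([] : List β)) by simp; omega)
      have r := Runs.assign b (.hd (.var b)) s
      have he : (Expr.hd (.var b)).eval s = enc a := by simp [Expr.eval, hh, BTree.hd]
      rw [he] at r
      refine ⟨s₃, _, .iteFalse ?_ (.seq r r3), v3,
        fun i hi => ?_, ?_⟩
      · simp [Expr.eval, hh, BTree.tl]
      · rw [k3 i hi, Function.update_of_ne (by omega)]
      · simp only [Expr.cost, Expr.eval, hx, sz_pair, sz_nil] at *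
        simp only [hh, BTree.tl, BTree.hd, BTree.size]
        simp only [sz] at *
        omega
    · have hh : s b = .pair (enc a) (enc (c :: l)) := h
      obtain ⟨s₃, t₃, r3, v3, k3, l3⟩ := hq (a, c, l) s h
      have := hle k' (show sz (a, c, l) ≤ sz (a, c :: l) by simp)
      refine ⟨s₃, _, .iteTrue ?_ r3, v3, k3, ?_⟩
      · simp only [Expr.eval, hh, BTree.tl]; exact BTree.noConfusion
      · have h5 : (enc (c :: l)).size = sz (c :: l) := rfl
        simp only [Expr.cost, Expr.eval, hx]
        simp only [hh, BTree.tl, h5]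
        simp only [sz_pair] at *
        omega

theorem list_cases {l : α → List β} {f : α → γ} {g : α × β × List β → γ} (hl : PolyTime l)
    (hf : PolyTime f) (hg : PolyTime g) :
    PolyTime (fun a => ((l a).casesOn (f a) fun b l => g (a, b, l) : γ)) :=
  comp₂ (list_cases' hf hg) id hl

end PolyTime

/-! ### Folding over lists -/

/-- The total size of the intermediate results of a fold. -/
def foldSize (step : α × β × γ → γ) (a : α) : List β → γ → ℕ
  | [], z => sz a + sz z + 3
  | b :: l, z => sz a + sz b + sz z + 3 + foldSize step a l (step (a, b, z))

theorem sz_le_foldSize (step : α × β × γ → γ) (a : α) (l : List β) (z : γ) :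
    sz (a, l, z) ≤ foldSize step a l z := by
  induction l generalizing z with
  | nil => simp [foldSize]; omega
  | cons b l ih =>
    have := ih (step (a, b, z))
    simp [foldSize] at this ⊢; omega

theorem sz_foldl_le_foldSize (step : α × β × γ → γ) (a : α) (l : List β) (z : γ) :
    sz (l.foldl (fun z b => step (a, b, z)) z) ≤ foldSize step a l z := by
  induction l generalizing z with
  | nil => simp [foldSize]; omega
  | cons b l ih =>
    have := ih (step (a, b, z))
    simp [foldSize] at this ⊢; omega

/-- The loop that computes a fold whose step is `p`. -/
def foldProg (p : Prog) (b : ℕ) : Prog :=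
  .loop (.var (b + 2))
     (.seq (.assign (b + 3) (.pair (.var (b + 1)) (.pair (.hd (.var (b + 2))) (.var b))))
       (.seq p (.seq (.assign b (.var (b + 3))) (.assign (b + 2) (.tl (.var (b + 2)))))))

/-- Variable `b` holds the accumulator, `b + 1` the context, `b + 2` the rest of the list, and `b +
3` is the workspace of the step. -/
theorem runs_foldl {step : α × β × γ → γ} {b c M : ℕ} {p : Prog}
    (hp : ∀ x, RunsAt p (b + 3) (enc x) (enc (step x)) ((sz x + 2) ^ c))
    (hs : ∀ x, sz (step x) ≤ (sz x + 2) ^ c)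
    (a : α) (l : List β) (z : γ) (s : Store) (h0 : s b = enc z) (h1 : s (b + 1) = enc a)
    (h2 : s (b + 2) = enc l) (hM : foldSize step a l z ≤ M) :
    ∃ s' t, Runs (foldProg p b) s s' t ∧
      s' b = enc (l.foldl (fun z b => step (a, b, z)) z) ∧ (∀ i < b, s' i = s i) ∧
      t ≤ (l.length + 1) * (20 * ((M + 2) ^ c + M + 1)) := by
  induction l generalizing z s with
  | nil =>
    have h2' : s (b + 2) = .leaf := h2
    refine ⟨s, _, .loopStop (by simpa [Expr.eval] using h2'), h0, fun _ _ => rfl, ?_⟩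
    simp only [Expr.cost, h2', BTree.size, List.length_nil]; omega
  | cons x l ih =>
    have h2' : s (b + 2) = .pair (enc x) (enc l) := h2
    have hM' := sz_le_foldSize step a l (step (a, x, z))
    simp only [foldSize] at hM
    simp only [sz_pair] at hM'
    have hxz : sz (a, x, z) ≤ M := by simp only [sz_pair]; omega
    have hle : (sz (a, x, z) + 2) ^ c ≤ (M + 2) ^ c := Nat.pow_le_pow_left (by omega) c
    have r1 := Runs.assign (b + 3) (.pair (.var (b + 1)) (.pair (.hd (.var (b + 2))) (.var b))) s
    have he : (Expr.pair (.var (b + 1)) (.pair (.hd (.var (b + 2))) (.var b))).eval s =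
        enc (a, x, z) := by simp only [Expr.eval, h0, h1, h2', BTree.hd]; rfl
    rw [he] at r1
    obtain ⟨s₂, t₂, r2, v2, k2, l2⟩ := hp (a, x, z) _ (Function.update_self (b + 3) _ s)
    have g1 : s₂ (b + 1) = enc a := by
      rw [k2 _ (by omega), Function.update_of_ne (by omega), h1]
    have g2 : s₂ (b + 2) = .pair (enc x) (enc l) := by
      rw [k2 _ (by omega), Function.update_of_ne (by omega), h2']
    have r3 := Runs.assign b (.var (b + 3)) s₂
    have r4 := Runs.assign (b + 2) (.tl (.var (b + 2)))
      (Function.update s₂ b ((Expr.var (b + 3)).eval s₂))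
    have he4 : (Expr.tl (.var (b + 2))).eval
        (Function.update s₂ b ((Expr.var (b + 3)).eval s₂)) = enc l := by
      simp only [Expr.eval]
      rw [Function.update_of_ne (by omega), g2]; rfl
    have hc4 : (Expr.tl (.var (b + 2))).cost
        (Function.update s₂ b ((Expr.var (b + 3)).eval s₂)) ≤ 2 * M + 4 := by
      simp only [Expr.cost, he4]
      rw [Function.update_of_ne (by omega), g2]
      simp only [BTree.size]
      simp only [sz] at *
      omega
    rw [he4] at r4
    obtain ⟨s₅, t₅, r5, v5, k5, l5⟩ := ih (step (a, x, z))
      (Function.update (Function.update s₂ b ((Expr.var (b + 3)).eval s₂)) (b + 2) (enc l))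
      (by rw [Function.update_of_ne (by omega), Function.update_self]; exact v2)
      (by rw [Function.update_of_ne (by omega), Function.update_of_ne (by omega), g1])
      (Function.update_self ..) (by omega)
    refine ⟨s₅, _, .loopStep ?_ (.seq r1 (.seq r2 (.seq r3 r4))) r5, v5, fun i hi => ?_, ?_⟩
    · simp only [Expr.eval, h2']; exact BTree.noConfusion
    · rw [k5 i hi, Function.update_of_ne (by omega), Function.update_of_ne (by omega),
        k2 i (by omega), Function.update_of_ne (by omega)]
    · have h7 := hs (a, x, z)
      have h8 : (Expr.pair (.var (b + 1)) (.pair (.hd (.var (b + 2))) (.var b))).cost s ≤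
          8 * M + 8 := by
        simp only [Expr.cost, Expr.eval, h0, h1, h2', BTree.hd, BTree.size]
        simp only [sz_pair] at hxz
        simp only [sz] at *
        omega
      have h9 : (Expr.var (b + 3)).cost s₂ ≤ (M + 2) ^ c + 1 := by
        simp only [Expr.cost, v2]
        simp only [sz] at *
        omega
      have h10 : (Expr.var (b + 2)).cost s ≤ M + 5 := by
        simp only [Expr.cost, h2', BTree.size]
        simp only [sz] at *
        omega
      rw [List.length_cons, add_mul (l.length + 1) 1]
      omega

/-- `foldSize` dominates both the number of rounds and the size of the input of every step, so the
total time is polynomial in it. What remains in each application is to bound `foldSize`. -/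
theorem timeIn_foldl {step : α × β × γ → γ} (hstep : PolyTime step) :
    TimeIn (fun x : α × List β × γ => foldSize step x.1 x.2.1 x.2.2)
      (fun x => x.2.1.foldl (fun z b => step (x.1, b, z)) x.2.2) := by
  obtain ⟨c, hs, hp⟩ := hstep
  refine TimeIn.intro (P := fun n => (n + 1) * (20 * ((n + 2) ^ c + n + 1)) + 50 * (n + 1))
    ((PolyBounded.id.add (.const 1)).mul ((PolyBounded.const 20).mul
      (((PolyBounded.exp c).add .id).add (.const 1))) |>.add
      ((PolyBounded.const 50).mul (PolyBounded.id.add (.const 1)))) (fun x => ?_) fun b => ?_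
  · have := sz_foldl_le_foldSize step x.1 x.2.1 x.2.2
    omega
  · obtain ⟨p, hp⟩ := hp (b + 3)
    refine ⟨.seq (.assign (b + 1) (.hd (.var b))) (.seq (.assign (b + 2) (.hd (.tl (.var b))))
      (.seq (.assign b (.tl (.tl (.var b)))) (foldProg p b))), fun x s h => ?_⟩
    · rcases x with ⟨a, l, z⟩
      have hh : s b = .pair (enc a) (.pair (enc l) (enc z)) := h
      have r1 := Runs.assign (b + 1) (.hd (.var b)) s
      have e1 : (Expr.hd (.var b)).eval s = enc a := by simp only [Expr.eval, hh, BTree.hd]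
      rw [e1] at r1
      have r2 := Runs.assign (b + 2) (.hd (.tl (.var b))) (Function.update s (b + 1) (enc a))
      have f2 : Function.update s (b + 1) (enc a) b = .pair (enc a) (.pair (enc l) (enc z)) := by
        rw [Function.update_of_ne (by omega), hh]
      have e2 : (Expr.hd (.tl (.var b))).eval (Function.update s (b + 1) (enc a)) = enc l := by
        simp only [Expr.eval, f2, BTree.hd, BTree.tl]
      rw [e2] at r2
      set s₂ := Function.update (Function.update s (b + 1) (enc a)) (b + 2) (enc l) with hs₂
      have f3 : s₂ b = .pair (enc a) (.pair (enc l) (enc z)) := by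
        rw [hs₂, Function.update_of_ne (by omega), f2]
      have r3 := Runs.assign b (.tl (.tl (.var b))) s₂
      have e3 : (Expr.tl (.tl (.var b))).eval s₂ = enc z := by
        simp only [Expr.eval, f3, BTree.tl]
      rw [e3] at r3
      obtain ⟨s₄, t₄, r4, v4, k4, l4⟩ := runs_foldl hp hs a l z (Function.update s₂ b (enc z))
        (Function.update_self ..)
        (by rw [Function.update_of_ne (by omega), hs₂, Function.update_of_ne (by omega),
              Function.update_self])
        (by rw [Function.update_of_ne (by omega), hs₂, Function.update_self]) le_rfl
      refine ⟨s₄, _, .seq r1 (.seq r2 (.seq r3 r4)), v4, fun i hi => ?_, ?_⟩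
      · rw [k4 i hi, Function.update_of_ne (by omega), hs₂, Function.update_of_ne (by omega),
          Function.update_of_ne (by omega)]
      · have hS := sz_le_foldSize step a l z
        have hlen := length_lt_sz l
        simp only [sz_pair] at hS
        have hmul : (l.length + 1) * (20 * ((foldSize step a l z + 2) ^ c + foldSize step a l z + 1))
            ≤ (foldSize step a l z + 1) *
              (20 * ((foldSize step a l z + 2) ^ c + foldSize step a l z + 1)) :=
          Nat.mul_le_mul_right _ (by omega)
        simp only [Expr.cost, Expr.eval, hh, f2, f3, BTree.hd, BTree.tl, BTree.size]
        simp only [sz] at hS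
        omega

end

/-! ### Bounds on the intermediate results of folds. -/

section

variable {α β γ δ : Type} [Enc α] [Enc β] [Enc γ] [Enc δ]

/-- A polynomial-time step alone is not enough, since iterating it may square the size each time.
Additive growth by an amount independent of the accumulator keeps the sum polynomial. -/
theorem foldSize_le {step : α × β × γ → γ} {a : α} {q B : ℕ} (l : List β) (z : γ)
    (hB : ∀ b ∈ l, sz b ≤ B) (hq : ∀ b ∈ l, ∀ z, sz (step (a, b, z)) ≤ sz z + q) :
    foldSize step a l z ≤ (l.length + 1) * (sz a + B + sz z + l.length * q + 3) := by
  induction l generalizing z with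
  | nil => simp [foldSize]
  | cons b l ih =>
    have h1 := ih (step (a, b, z)) (fun b hb => hB b (by simp [hb])) fun b hb => hq b (by simp [hb])
    have h2 := hq b (by simp) z
    have h3 := hB b (by simp)
    have h4 : (l.length + 1) * (sz a + B + sz (step (a, b, z)) + l.length * q + 3) ≤
        (l.length + 1) * (sz a + B + sz z + (l.length + 1) * q + 3) :=
      Nat.mul_le_mul_left _ (by rw [add_mul]; omega)
    rw [foldSize, List.length_cons, add_mul (l.length + 1) 1]
    omega

/-- Polynomial time folds, if every step increases the size by a polynomial in the context. -/
theorem PolyTime.foldl {l : α → List β} {z : α → γ} {step : α → β → γ → γ} (hl : PolyTime l)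
    (hz : PolyTime z) (hstep : PolyTime fun x : α × β × γ => step x.1 x.2.1 x.2.2) {Q : ℕ → ℕ}
    (hQ : PolyBounded Q) (h : ∀ a, ∀ b ∈ l a, ∀ z, sz (step a b z) ≤ sz z + Q (sz a)) :
    PolyTime (fun a => (l a).foldl (fun z b => step a b z) (z a)) := by
  obtain ⟨c, hc, _⟩ := _root_.id hl
  obtain ⟨d, hd, _⟩ := _root_.id hz
  refine TimeIn.comp (timeIn_foldl hstep) (PolyTime.id.pair (hl.pair hz)) (Q := fun n =>
    ((n + 2) ^ c + 1) * (n + (n + 2) ^ c + (n + 2) ^ d + (n + 2) ^ c * Q n + 3))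
    (((PolyBounded.exp c).add (.const 1)).mul ((((PolyBounded.id.add (.exp c)).add (.exp d)).add
      ((PolyBounded.exp c).mul hQ)).add (.const 3))) fun a => ?_
  refine (foldSize_le (q := Q (sz a)) (B := (sz a + 2) ^ c) (l a) (z a)
    (fun b hb => (sz_le_of_mem hb).le.trans (hc a)) (h a)).trans ?_
  have h1 := (length_lt_sz (l a)).le.trans (hc a)
  have h2 := hd a
  gcongr

/-- The variant for folds whose intermediate results are small for a global reason, such as the
enumeration of subsets and the numbering of bags. -/
theorem foldSize_le_of_bound {step : α × β × γ → γ} {a : α} {Q B : ℕ} (l : List β) (z : γ)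
    (hB : ∀ b ∈ l, sz b ≤ B)
    (hQ : ∀ l₁ l₂, l = l₁ ++ l₂ → sz (l₁.foldl (fun z b => step (a, b, z)) z) ≤ Q) :
    foldSize step a l z ≤ (l.length + 1) * (sz a + B + Q + 3) := by
  induction l generalizing z with
  | nil =>
    have := hQ [] [] rfl
    simp only [List.foldl_nil] at this
    simp [foldSize]; omega
  | cons b l ih =>
    have h1 := ih (step (a, b, z)) (fun b hb => hB b (by simp [hb]))
      fun l₁ l₂ h => hQ (b :: l₁) l₂ (by simp [h])
    have h2 := hQ [] (b :: l) rfl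
    have h3 := hB b (by simp)
    simp only [List.foldl_nil] at h2
    rw [foldSize, List.length_cons, add_mul (l.length + 1) 1]
    omega

/-- Folds in time polynomial in a measure, if all intermediate results are bounded. -/
theorem TimeIn.foldl_of_bound {m : α → ℕ} (hm : ∀ a, sz a ≤ m a) {l : α → List β} {z : α → γ}
    {step : α → β → γ → γ} (hl : TimeIn m l)
    (hz : TimeIn m z) (hstep : PolyTime fun x : α × β × γ => step x.1 x.2.1 x.2.2) {Q : ℕ → ℕ}
    (hQ : PolyBounded Q) (h : ∀ a l₁ l₂, l a = l₁ ++ l₂ →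
      sz (l₁.foldl (fun z b => step a b z) (z a)) ≤ Q (m a)) :
    TimeIn m (fun a => (l a).foldl (fun z b => step a b z) (z a)) := by
  obtain ⟨c, hc, _⟩ := _root_.id hl
  have hid : TimeIn m (fun a => a) := PolyTime.id.timeIn PolyBounded.id hm
  refine TimeIn.comp (timeIn_foldl hstep) (TimeIn.pair hm hid (TimeIn.pair hm hl hz)) (Q := fun n =>
    ((n + 2) ^ c + 1) * (n + (n + 2) ^ c + Q n + 3))
    (((PolyBounded.exp c).add (.const 1)).mul (((PolyBounded.id.add (.exp c)).add hQ).add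
      (.const 3))) fun a => ?_
  refine (foldSize_le_of_bound (Q := Q (m a)) (B := (m a + 2) ^ c) (l a) (z a)
    (fun b hb => (sz_le_of_mem hb).le.trans (hc a)) (h a)).trans ?_
  have h1 := (length_lt_sz (l a)).le.trans (hc a)
  have h2 := hm a
  gcongr

/-! ### Polynomial-time operations on lists and truth values. -/

namespace PolyTime

theorem foldl_of_bound {l : α → List β} {z : α → γ} {step : α → β → γ → γ} (hl : PolyTime l)
    (hz : PolyTime z) (hstep : PolyTime fun x : α × β × γ => step x.1 x.2.1 x.2.2) {Q : ℕ → ℕ}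
    (hQ : PolyBounded Q) (h : ∀ a l₁ l₂, l a = l₁ ++ l₂ →
      sz (l₁.foldl (fun z b => step a b z) (z a)) ≤ Q (sz a)) :
    PolyTime (fun a => (l a).foldl (fun z b => step a b z) (z a)) :=
  TimeIn.foldl_of_bound (fun _ => le_rfl) hl hz hstep hQ h

theorem reverse {l : α → List β} (hl : PolyTime l) : PolyTime (fun a => (l a).reverse) := by
  have := foldl (step := fun _ b z => b :: z) hl (const ([] : List β))
    (cons (fst (snd id)) (snd (snd id))) (Q := fun n => n + 1 + _)
    (((PolyBounded.id).add (.const 1)).add (PolyBounded.exp (Classical.choose hl)))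
    fun a b hb z => by
      have h1 := (Classical.choose_spec hl).1 a
      have h2 := sz_le_of_mem hb
      simp only [sz_cons]; omega
  simpa [List.foldl_flip_cons_eq_append] using this

theorem append {l l' : α → List β} (hl : PolyTime l) (hl' : PolyTime l') :
    PolyTime (fun a => l a ++ l' a) := by
  have := foldl (step := fun _ b z => b :: z) hl.reverse hl'
    (cons (fst (snd id)) (snd (snd id))) (Q := fun n => n + 1 + _)
    (((PolyBounded.id).add (.const 1)).add (PolyBounded.exp (Classical.choose hl)))
    fun a b hb z => by
      have h1 := (Classical.choose_spec hl).1 a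
      have h2 := sz_le_of_mem (List.mem_reverse.1 hb)
      simp only [sz_cons]; omega
  simpa [List.foldl_flip_cons_eq_append] using this

theorem flatMap {l : α → List β} {f : α → β → List γ} (hl : PolyTime l)
    (hf : PolyTime fun x : α × β => f x.1 x.2) : PolyTime (fun a => (l a).flatMap (f a)) := by
  obtain ⟨c, hc, _⟩ := _root_.id hl
  obtain ⟨d, hd, _⟩ := _root_.id hf
  have := foldl (step := fun a b z => z ++ f a b) hl (const ([] : List γ))
    (append (snd (snd id)) (hf.comp (pair (fst id) (fst (snd id)))))
    (Q := fun n => (n + (n + 2) ^ c + 1 + 2) ^ d)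
    ((((PolyBounded.id.add (.exp c)).add (.const 1)).add (.const 2)).pow d)
    fun a b hb z => by
      have h1 := hc a
      have h2 := sz_le_of_mem hb
      have h3 := hd (a, b)
      have h4 := sz_append z (f a b)
      have h5 : (sz (a, b) + 2) ^ d ≤ (sz a + (sz a + 2) ^ c + 1 + 2) ^ d :=
        Nat.pow_le_pow_left (by simp only [sz_pair]; omega) d
      dsimp only at h3
      omega
  have key : ∀ (a : α) (l : List β) (z : List γ),
      l.foldl (fun z b => z ++ f a b) z = z ++ l.flatMap (f a) := by
    intro a l
    induction l with
    | nil => simp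
    | cons b l ih => intro z; simp [ih]
  simpa only [key, List.nil_append] using this

theorem map {l : α → List β} {f : α → β → γ} (hl : PolyTime l)
    (hf : PolyTime fun x : α × β => f x.1 x.2) : PolyTime (fun a => (l a).map (f a)) := by
  have := flatMap (f := fun a b => [f a b]) hl (cons hf (const []))
  simpa only [← List.map_eq_flatMap] using this

theorem filter {l : α → List β} {p : α → β → Bool} (hl : PolyTime l)
    (hp : PolyTime fun x : α × β => p x.1 x.2) : PolyTime (fun a => (l a).filter (p a)) := by
  have := flatMap (f := fun a b => if p a b then [b] else []) hl
    (ite hp (cons (snd id) (const [])) (const []))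
  have key : ∀ (a : α) (l : List β),
      l.flatMap (fun b => if p a b then [b] else []) = l.filter (p a) := by
    intro a l
    induction l with
    | nil => simp
    | cons b l ih => simp only [List.flatMap_cons, List.filter_cons, ih]; split <;> simp
  simpa only [key] using this

theorem flatten {l : α → List (List β)} (hl : PolyTime l) : PolyTime (fun a => (l a).flatten) := by
  simpa only [List.flatMap_id'] using flatMap (f := fun _ b => b) hl (snd id)

theorem not {p : α → Bool} (hp : PolyTime p) : PolyTime (fun a => !p a) := by
  simpa using ite hp (const false) (const true)

theorem and {p q : α → Bool} (hp : PolyTime p) (hq : PolyTime q) :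
    PolyTime (fun a => p a && q a) := by
  simpa using ite hp hq (const false)

theorem or {p q : α → Bool} (hp : PolyTime p) (hq : PolyTime q) :
    PolyTime (fun a => p a || q a) := by
  simpa using ite hp (const true) hq

theorem any {l : α → List β} {p : α → β → Bool} (hl : PolyTime l)
    (hp : PolyTime fun x : α × β => p x.1 x.2) : PolyTime (fun a => (l a).any (p a)) := by
  have := foldl (step := fun a b z => p a b || z) hl (const false)
    (or (hp.comp (pair (fst id) (fst (snd id)))) (snd (snd id))) (.const 3)
    fun a b _ z => (sz_bool_le _).trans (by omega)
  have key : ∀ (a : α) (l : List β) (z : Bool),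
      l.foldl (fun z b => p a b || z) z = (l.any (p a) || z) := by
    intro a l
    induction l with
    | nil => simp
    | cons b l ih => intro z; simp only [List.foldl_cons, ih, List.any_cons]; grind
  simpa only [key, Bool.or_false] using this

theorem all {l : α → List β} {p : α → β → Bool} (hl : PolyTime l)
    (hp : PolyTime fun x : α × β => p x.1 x.2) : PolyTime (fun a => (l a).all (p a)) := by
  have := not (any (p := fun a b => !p a b) hl (not hp))
  simpa [List.not_any_eq_all_not] using this

theorem mem (hβ : Function.Injective (enc : β → BTree)) {f : α → β} {l : α → List β}
    [∀ a, Decidable (f a ∈ l a)] (hf : PolyTime f) (hl : PolyTime l) :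
    PolyTime (fun a => decide (f a ∈ l a)) := by
  classical
  have := any (p := fun a b => decide (f a = b)) hl
    (comp₂ (eq' (e := fun x y => decide (x = y)) fun x y => by simp [hβ.eq_iff])
      (hf.comp (fst id)) (snd id))
  convert this using 2 with a
  rw [Bool.eq_iff_iff]
  simp

/-- The list serves only as a unary counter for the rounds. -/
theorem iterate {l : α → List β} {z : α → γ} {f : α → γ → γ} (hl : PolyTime l) (hz : PolyTime z)
    (hf : PolyTime fun x : α × γ => f x.1 x.2) {Q : ℕ → ℕ} (hQ : PolyBounded Q)
    (h : ∀ a z, sz (f a z) ≤ sz z + Q (sz a)) :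
    PolyTime (fun a => (f a)^[(l a).length] (z a)) := by
  have := foldl (step := fun a _ z => f a z) hl hz (hf.comp (pair (fst id) (snd (snd id)))) hQ
    fun a _ _ z => h a z
  have key : ∀ (a : α) (l : List β) (z : γ),
      l.foldl (fun z _ => f a z) z = (f a)^[l.length] z := by
    intro a l
    induction l with
    | nil => simp
    | cons b l ih => intro z; simp [ih]
  simpa only [key] using this

/-- A bound on the size of a polynomial time function. -/
theorem exists_bound {f : α → β} (hf : PolyTime f) :
    ∃ Q, PolyBounded Q ∧ Monotone Q ∧ ∀ a, sz (f a) ≤ Q (sz a) := by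
  obtain ⟨c, hc, _⟩ := hf
  exact ⟨_, .exp c, fun m n h => Nat.pow_le_pow_left (by omega) c, hc⟩

end PolyTime

/-! ### Injectivity of the encodings. -/

theorem encBool_injective : Function.Injective encBool := by
  rintro (_ | _) (_ | _) h <;> simp_all [encBool]

theorem encList_injective {α : Type} {e : α → BTree} (he : Function.Injective e) :
    Function.Injective (encList e) := by
  intro l
  induction l with
  | nil => rintro (_ | ⟨b, l'⟩) h <;> simp_all [encList]
  | cons a l ih =>
    rintro (_ | ⟨b, l'⟩) h
    · simp [encList] at h
    · simp only [encList, BTree.pair.injEq] at h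
      rw [he h.1, ih h.2]

theorem bits_injective : Function.Injective Nat.bits := by
  intro m n h
  have : ∀ n : ℕ, Nat.ofDigits 2 (n.bits.map fun b => cond b 1 0) = n := fun n => by
    rw [← Nat.digits_two_eq_bits, Nat.ofDigits_digits]
  rw [← this m, h, this n]

theorem enc_nat_injective : Function.Injective (enc : ℕ → BTree) := fun _ _ h =>
  bits_injective (encList_injective encBool_injective h)

theorem enc_list_nat_injective : Function.Injective (enc : List ℕ → BTree) :=
  encList_injective enc_nat_injective

/-! ### Successor -/

/-- Binary increment. -/
def incBits : List Bool → List Bool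
  | [] => [true]
  | false :: l => true :: l
  | true :: l => false :: incBits l

theorem bits_succ (n : ℕ) : (n + 1).bits = incBits n.bits := by
  induction n using Nat.binaryRec' with
  | zero => simp [incBits]
  | bit b n h ih =>
    rw [Nat.bits_append_bit _ _ h]
    cases b with
    | false =>
      simp only [Nat.bit, cond_false, incBits]
      exact Nat.bit1_bits n
    | true =>
      simp only [Nat.bit, cond_true, incBits, ← ih]
      rw [← Nat.bit0_bits (n + 1) (by omega)]; congr 1

/-- One step of the increment: the state is a carry and the reversed output. -/
def incStep (b : Bool) (z : Bool × List Bool) : Bool × List Bool :=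
  if z.1 then (if b then (true, false :: z.2) else (false, true :: z.2)) else (false, b :: z.2)

theorem incStep_false (b : Bool) (l : List Bool) : incStep b (false, l) = (false, b :: l) := rfl
theorem incStep_false_true (l : List Bool) : incStep false (true, l) = (false, true :: l) := rfl

theorem foldl_incStep_false (l acc : List Bool) :
    l.foldl (fun z b => incStep b z) (false, acc) = (false, l.reverse ++ acc) := by
  induction l generalizing acc with
  | nil => simp
  | cons b l ih => rw [List.foldl_cons, incStep_false, ih]; simp

/-- While the carry persists, a one turns into a zero; once the carry is absorbed, the remaining
digits are copied. A carry that survives to the end becomes a new most significant digit. -/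
theorem foldl_incStep_true (l acc : List Bool) :
    let r := l.foldl (fun z b => incStep b z) (true, acc)
    acc.reverse ++ incBits l = (if r.1 then true :: r.2 else r.2).reverse := by
  induction l generalizing acc with
  | nil => simp [incBits]
  | cons b l ih =>
    cases b with
    | false =>
      intro r
      simp only [r, List.foldl_cons, incStep_false_true, foldl_incStep_false]
      simp [incBits]
    | true =>
      have h : acc.reverse ++ incBits (true :: l) = (false :: acc).reverse ++ incBits l := by
        simp [incBits]
      exact h.trans (ih (false :: acc))

theorem PolyTime.succ : PolyTime (fun n : ℕ => n + 1) := by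
  have h0 : PolyTime Nat.bits := cast fun n => rfl
  have h1 := foldl (step := fun (_ : List Bool) b z => incStep b z) id (const (true, []))
    (ite (fst (snd (snd id)))
      (ite (fst (snd id)) (pair (const true) (cons (const false) (snd (snd (snd id)))))
        (pair (const false) (cons (const true) (snd (snd (snd id))))))
      (pair (const false) (cons (fst (snd id)) (snd (snd (snd id)))))) (.const 10)
    fun a b _ z => by
      have h3 : ∀ b : Bool, sz b ≤ 3 := sz_bool_le
      obtain ⟨c, l⟩ := z
      have := h3 b
      have := h3 true
      have := h3 false
      simp only [incStep]
      split <;> [split; skip] <;> simp only [sz_pair, sz_cons] <;> omega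
  have h2 := reverse (ite (fst h1) (cons (const true) (snd h1)) (snd h1))
  have h3 : PolyTime incBits := by
    convert h2 using 2 with l
    exact (foldl_incStep_true l []).symm ▸ rfl
  obtain ⟨c, hs, hp⟩ := h3.comp h0
  have h : ∀ n : ℕ, enc (n + 1) = enc (incBits n.bits) := fun n =>
    congrArg (encList encBool) (bits_succ n)
  refine ⟨c, fun n => ?_, fun b => ?_⟩
  · have := hs n
    simp only [sz, h] at this ⊢; exact this
  · obtain ⟨p, hp⟩ := hp b
    refine ⟨p, fun n => ?_⟩
    rw [h]; exact hp n

end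

/-! ### The algorithm -/

/-- A bag with a label. -/
abbrev Bag : Type := List ℕ × List (List ℕ)

/-- The vertices of a list of hyperedges. -/
def verts (E : List (List ℕ)) : List ℕ := E.flatten

/-- Does `u` share a hyperedge with an element of `C`? -/
def touches (E : List (List ℕ)) (C : List ℕ) (u : ℕ) : Bool :=
  E.any fun e => decide (u ∈ e) && e.any fun w => decide (w ∈ C)

/-- Add to `R` all its neighbours outside `S`. -/
def grow (E : List (List ℕ)) (S R : List ℕ) : List ℕ :=
  (verts E).filter fun u => decide (u ∈ R) || (!decide (u ∈ S) && touches E R u)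

/-- The vertices that can be reached from `v` without entering `S`. -/
def component (E : List (List ℕ)) (S : List ℕ) (v : ℕ) : List ℕ :=
  (grow E S)^[(verts E).length] ((verts E).filter fun u => decide (u ∈ [v]))

/-- Is `u` a neighbour of `C` outside `C`? -/
def isNbr (E : List (List ℕ)) (C : List ℕ) (u : ℕ) : Bool :=
  !decide (u ∈ C) && touches E C u

/-- `B` contains the neighbours of `C`, is contained in `C` and its neighbours, meets `C`, and
splits `C` into components that are listed in `T`. -/
def goodBag (E T : List (List ℕ)) (C B : List ℕ) : Bool :=
  ((verts E).all fun u => !isNbr E C u || decide (u ∈ B)) &&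
    (B.all fun u => decide (u ∈ C) || isNbr E C u) &&
    (C.any fun u => decide (u ∈ B)) &&
    C.all fun v => decide (v ∈ B) || decide (component E B v ∈ T)

/-- All components of the complements of bags. -/
def allComponents (E : List (List ℕ)) (BB : List Bag) : List (List ℕ) :=
  BB.flatMap fun B => ((verts E).filter fun v => !decide (v ∈ B.1)).map fun v => component E B.1 v

/-- Discard the components without a good bag. -/
def prune (E : List (List ℕ)) (BB : List Bag) (T : List (List ℕ)) : List (List ℕ) :=
  T.filter fun C => BB.any fun B => goodBag E T C B.1

/-- The components that can be decomposed. -/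
def solvable (E : List (List ℕ)) (BB : List Bag) : List (List ℕ) :=
  (prune E BB)^[(allComponents E BB).length] (allComponents E BB)

/-- The vertices in the bags of `L`. -/
def covered (L : List Bag) : List ℕ := (L.map fun B => B.1).flatten

/-- The bags that may be added to the partial decomposition `L`. -/
def nextBags (E : List (List ℕ)) (BB : List Bag) (T : List (List ℕ)) (L : List Bag) : List Bag :=
  ((verts E).filter fun v => !decide (v ∈ covered L)).flatMap fun v =>
    BB.filter fun B => goodBag E T (component E (covered L) v) B.1

/-- Add a bag to a partial decomposition, if possible. -/
def extend (E : List (List ℕ)) (BB : List Bag) (T : List (List ℕ)) (L : List Bag) : List Bag :=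
  match nextBags E BB T L with
  | [] => L
  | B :: _ => B :: L

/-- A decomposition with bags in `BB`, listed from the last to the first, if there is one. -/
def decomposition (E : List (List ℕ)) (BB : List Bag) : List Bag :=
  (extend E BB (solvable E BB))^[(verts E).length] [([], [])]

/-- Is `L` complete? -/
def isComplete (E : List (List ℕ)) (BB L : List Bag) : Bool :=
  (BB.any fun _ => true) && (verts E).all fun v => decide (v ∈ covered L)

/-! ### Running time of the greedy decomposition. -/

namespace PolyTime

section

variable {α β γ : Type} [Enc α] [Enc β] [Enc γ]

theorem onFst {f : α → γ} (hf : PolyTime f) : PolyTime (fun x : α × β => f x.1) :=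
  hf.comp (fst id)

theorem memNat {f : α → ℕ} {l : α → List ℕ} (hf : PolyTime f) (hl : PolyTime l) :
    PolyTime (fun a => decide (f a ∈ l a)) := mem enc_nat_injective hf hl

theorem verts {E : α → List (List ℕ)} (hE : PolyTime E) : PolyTime (fun a => verts (E a)) :=
  flatten hE

theorem touches {E : α → List (List ℕ)} {C : α → List ℕ} {u : α → ℕ} (hE : PolyTime E)
    (hC : PolyTime C) (hu : PolyTime u) : PolyTime (fun a => touches (E a) (C a) (u a)) :=
  any hE (and (memNat hu.onFst (snd id)) (any (snd id) (memNat (snd id) hC.onFst.onFst)))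

theorem grow {E : α → List (List ℕ)} {S R : α → List ℕ} (hE : PolyTime E)
    (hS : PolyTime S) (hR : PolyTime R) : PolyTime (fun a => grow (E a) (S a) (R a)) :=
  filter hE.verts (or (memNat (snd id) hR.onFst)
    (and (not (memNat (snd id) hS.onFst)) (touches hE.onFst hR.onFst (snd id))))

theorem component {E : α → List (List ℕ)} {S : α → List ℕ} {v : α → ℕ} (hE : PolyTime E)
    (hS : PolyTime S) (hv : PolyTime v) : PolyTime (fun a => component (E a) (S a) (v a)) := by
  obtain ⟨Q, hQ, -, h⟩ := hE.verts.exists_bound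
  exact iterate (f := fun a R => TreeProj.grow (E a) (S a) R) hE.verts
    (filter hE.verts (memNat (snd id) (cons hv.onFst (const []))))
    (grow hE.onFst hS.onFst (snd id)) hQ
    fun a z => ((sz_le_of_sublist List.filter_sublist).trans (h a)).trans (by omega)

theorem isNbr {E : α → List (List ℕ)} {C : α → List ℕ} {u : α → ℕ} (hE : PolyTime E)
    (hC : PolyTime C) (hu : PolyTime u) : PolyTime (fun a => isNbr (E a) (C a) (u a)) :=
  and (not (memNat hu hC)) (touches hE hC hu)

theorem goodBag {E T : α → List (List ℕ)} {C B : α → List ℕ} (hE : PolyTime E) (hT : PolyTime T)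
    (hC : PolyTime C) (hB : PolyTime B) :
    PolyTime (fun a => goodBag (E a) (T a) (C a) (B a)) :=
  and (and (and
    (all hE.verts (or (not (isNbr hE.onFst hC.onFst (snd id))) (memNat (snd id) hB.onFst)))
    (all hB (or (memNat (snd id) hC.onFst) (isNbr hE.onFst hC.onFst (snd id)))))
    (any hC (memNat (snd id) hB.onFst)))
    (all hC (or (memNat (snd id) hB.onFst)
      (mem enc_list_nat_injective (component hE.onFst hB.onFst (snd id)) hT.onFst)))

theorem allComponents {E : α → List (List ℕ)} {BB : α → List Bag} (hE : PolyTime E)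
    (hB : PolyTime BB) : PolyTime (fun a => allComponents (E a) (BB a)) :=
  flatMap hB (map (filter hE.onFst.verts (not (memNat (snd id) (fst (snd (fst id))))))
    (component hE.onFst.onFst (fst (snd (fst id))) (snd id)))

theorem prune {E T : α → List (List ℕ)} {BB : α → List Bag} (hE : PolyTime E)
    (hB : PolyTime BB) (hT : PolyTime T) : PolyTime (fun a => prune (E a) (BB a) (T a)) :=
  filter hT (any hB.onFst (goodBag hE.onFst.onFst hT.onFst.onFst (snd (fst id)) (fst (snd id))))

theorem solvable {E : α → List (List ℕ)} {BB : α → List Bag} (hE : PolyTime E)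
    (hB : PolyTime BB) : PolyTime (fun a => solvable (E a) (BB a)) :=
  iterate (f := fun a T => TreeProj.prune (E a) (BB a) T) (allComponents hE hB)
    (allComponents hE hB) (prune hE.onFst hB.onFst (snd id)) (.const 0)
    fun _ _ => sz_le_of_sublist List.filter_sublist

theorem covered {L : α → List Bag} (hL : PolyTime L) : PolyTime (fun a => covered (L a)) :=
  flatten (map hL (fst (snd id)))

theorem nextBags {E T : α → List (List ℕ)} {BB L : α → List Bag} (hE : PolyTime E)
    (hB : PolyTime BB) (hT : PolyTime T) (hL : PolyTime L) :
    PolyTime (fun a => nextBags (E a) (BB a) (T a) (L a)) :=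
  flatMap (filter hE.verts (not (memNat (snd id) hL.covered.onFst)))
    (filter hB.onFst (goodBag hE.onFst.onFst hT.onFst.onFst
      (component hE.onFst.onFst hL.covered.onFst.onFst (snd (fst id))) (fst (snd id))))

theorem extend {E T : α → List (List ℕ)} {BB L : α → List Bag} (hE : PolyTime E)
    (hB : PolyTime BB) (hT : PolyTime T) (hL : PolyTime L) :
    PolyTime (fun a => extend (E a) (BB a) (T a) (L a)) := by
  convert list_cases (g := fun x : α × Bag × List Bag => x.2.1 :: L x.1)
    (nextBags hE hB hT hL) hL (cons (fst (snd id)) hL.onFst) using 2 with a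
  unfold TreeProj.extend
  cases TreeProj.nextBags (E a) (BB a) (T a) (L a) <;> rfl

end

end PolyTime

/-- A new bag is an element of `BB`, so a round adds at most about the size of `BB`. This is the
additive growth needed for iteration. -/
theorem sz_extend_le (E T : List (List ℕ)) (BB L : List Bag) :
    sz (extend E BB T L) ≤ sz L + (sz BB + 1) := by
  unfold extend
  cases h : nextBags E BB T L with
  | nil => dsimp only; omega
  | cons B l =>
    have hB : B ∈ nextBags E BB T L := by simp [h]
    obtain ⟨v, -, hB⟩ := List.mem_flatMap.1 hB
    have := sz_le_of_mem (List.mem_filter.1 hB).1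
    simp only [sz_cons]; omega

namespace PolyTime

variable {α : Type} [Enc α]

theorem decomposition {E : α → List (List ℕ)} {BB : α → List Bag} (hE : PolyTime E)
    (hB : PolyTime BB) : PolyTime (fun a => decomposition (E a) (BB a)) := by
  obtain ⟨Q, hQ, -, h⟩ := hB.exists_bound
  exact iterate (f := fun a L => TreeProj.extend (E a) (BB a) (TreeProj.solvable (E a) (BB a)) L)
    hE.verts (const _) (extend hE.onFst hB.onFst (solvable hE hB).onFst (snd id))
    (hQ.add (.const 1)) fun a z => (sz_extend_le _ _ _ _).trans (by have := h a; omega)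

theorem isComplete {E : α → List (List ℕ)} {BB L : α → List Bag} (hE : PolyTime E)
    (hB : PolyTime BB) (hL : PolyTime L) :
    PolyTime (fun a => isComplete (E a) (BB a) (L a)) :=
  and (any hB (const _)) (all hE.verts (memNat (snd id) hL.covered.onFst))

end PolyTime

/-! ### Components -/

/-- As long as `K` fails, `μ` drops, so `μ s` rounds suffice, and further rounds are harmless. This
turns the fixed iteration counts of the algorithm into statements about fixed points. -/
theorem iterate_reaches {σ : Type*} {f : σ → σ} (μ : σ → ℕ) (K : σ → Prop)
    (h : ∀ s, K s ∨ μ (f s) < μ s) (hK : ∀ s, K s → K (f s)) {n : ℕ} {s : σ} (hn : μ s ≤ n) :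
    K (f^[n] s) := by
  have hit : ∀ n s, K s → K (f^[n] s) := by
    intro n
    induction n with
    | zero => exact fun s hs => hs
    | succ n ih => exact fun s hs => ih _ (hK s hs)
  induction n generalizing s with
  | zero => exact (h s).resolve_right (by omega)
  | succ n ih =>
    rcases h s with h | h
    · exact hit _ _ h
    · exact ih (by omega)

theorem length_filter_lt {α : Type*} {p q : α → Bool} {l : List α}
    (h : ∀ x ∈ l, p x = true → q x = true) {x : α} (hx : x ∈ l) (hq : q x = true)
    (hp : p x = false) : (l.filter p).length < (l.filter q).length := by
  induction l with
  | nil => simp at hx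
  | cons a l ih =>
    have hle : (l.filter p).length ≤ (l.filter q).length := by
      simpa only [List.countP_eq_length_filter] using
        List.countP_mono_left fun x hx => h x (by simp [hx])
    rcases List.mem_cons.1 hx with rfl | hx
    · simp [hq, hp]; omega
    · have := ih (fun x hx => h x (by simp [hx])) hx
      have ha := h a (by simp)
      simp only [List.filter_cons]
      split <;> split <;> simp_all

section

variable {E : List (List ℕ)}

/-- Two vertices are adjacent if they lie on a common hyperedge. -/
def Adjacent (E : List (List ℕ)) (x y : ℕ) : Prop := ∃ e ∈ E, x ∈ e ∧ y ∈ e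

theorem Adjacent.symm {x y : ℕ} (h : Adjacent E x y) : Adjacent E y x := by
  obtain ⟨e, he, hx, hy⟩ := h
  exact ⟨e, he, hy, hx⟩

theorem mem_verts {x : ℕ} : x ∈ verts E ↔ ∃ e ∈ E, x ∈ e := by simp [verts]

theorem Adjacent.mem_verts {x y : ℕ} (h : Adjacent E x y) : y ∈ verts E := by
  obtain ⟨e, he, hx, hy⟩ := h
  exact TreeProj.mem_verts.2 ⟨e, he, hy⟩

theorem touches_iff {C : List ℕ} {u : ℕ} :
    touches E C u = true ↔ ∃ w ∈ C, Adjacent E w u := by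
  simp only [touches, Adjacent, List.any_eq_true, Bool.and_eq_true, decide_eq_true_eq]
  constructor
  · rintro ⟨e, he, hu, w, hw, hC⟩
    exact ⟨w, hC, e, he, hw, hu⟩
  · rintro ⟨w, hC, e, he, hw, hu⟩
    exact ⟨e, he, hu, w, hw, hC⟩

theorem mem_grow {S R : List ℕ} {u : ℕ} : u ∈ grow E S R ↔
    u ∈ verts E ∧ (u ∈ R ∨ u ∉ S ∧ ∃ w ∈ R, Adjacent E w u) := by
  simp [grow, touches_iff]

/-- Reachability without entering `S`. -/
def Reach (E : List (List ℕ)) (S : List ℕ) : ℕ → ℕ → Prop :=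
  Relation.ReflTransGen fun x y => Adjacent E x y ∧ y ∉ S

/-- A round that leaves the set not yet closed adds a vertex, so the set is closed after as many
rounds as there are entries in `verts E`. -/
theorem mem_component {S : List ℕ} {v u : ℕ} (hv : v ∈ verts E) :
    u ∈ component E S v ↔ Reach E S v u := by
  set R₀ := (verts E).filter fun u => decide (u ∈ [v]) with hR₀
  have hstart : ∀ n, v ∈ (grow E S)^[n] R₀ := by
    intro n
    induction n with
    | zero => simp [hR₀, hv]
    | succ n ih =>
      rw [Function.iterate_succ_apply', mem_grow]
      exact ⟨hv, .inl ih⟩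
  constructor
  · have key : ∀ n, ∀ u ∈ (grow E S)^[n] R₀, Reach E S v u := by
      intro n
      induction n with
      | zero =>
        intro u hu
        obtain ⟨-, rfl⟩ : u ∈ verts E ∧ u = v := by simpa [hR₀] using hu
        exact .refl
      | succ n ih =>
        intro u hu
        rw [Function.iterate_succ_apply', mem_grow] at hu
        obtain ⟨-, hu | ⟨hS, w, hw, h⟩⟩ := hu
        · exact ih u hu
        · exact (ih w hw).tail ⟨h, hS⟩
    exact key _ u
  · have hclosed : ∀ u ∈ verts E, u ∉ S → (∃ w ∈ component E S v, Adjacent E w u) →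
        u ∈ component E S v := by
      -- The measure counts the vertices not yet reached.
      refine iterate_reaches (fun R => ((verts E).filter fun u => decide (u ∉ R)).length)
        (fun R => ∀ u ∈ verts E, u ∉ S → (∃ w ∈ R, Adjacent E w u) → u ∈ R) (fun R => ?_)
        (fun R hR u hu hS hw => ?_) (List.length_filter_le _ _)
      · by_cases h : ∀ u ∈ verts E, u ∉ S → (∃ w ∈ R, Adjacent E w u) → u ∈ R
        · exact .inl h
        · push Not at h
          obtain ⟨u, hu, hS, hw, hR⟩ := h
          refine .inr (length_filter_lt (fun x hx h => ?_) hu (by simpa using hR) ?_)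
          · simp only [decide_eq_true_eq] at h ⊢
            exact fun hx' => h (mem_grow.2 ⟨hx, .inl hx'⟩)
          · simp only [decide_eq_false_iff_not, not_not]
            exact mem_grow.2 ⟨hu, .inr ⟨hS, hw⟩⟩
      · obtain ⟨w, hw, ha⟩ := hw
        refine mem_grow.2 ⟨hu, .inl (hR u hu hS ⟨w, ?_, ha⟩)⟩
        obtain ⟨hwV, hw | ⟨hwS, hw⟩⟩ := mem_grow.1 hw
        · exact hw
        · exact hR w hwV hwS hw
    intro h
    induction h with
    | refl => exact hstart _
    | tail _ h ih => exact hclosed _ h.1.mem_verts h.2 ⟨_, ih, h.1⟩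

/-- Components are canonical lists: having the same elements makes them equal. This is why the
algorithm may compare components as lists. -/
theorem exists_component_eq_filter (S : List ℕ) (v : ℕ) :
    ∃ p : ℕ → Bool, component E S v = (verts E).filter p := by
  rw [component]
  cases (verts E).length with
  | zero => exact ⟨_, rfl⟩
  | succ n => rw [Function.iterate_succ_apply']; exact ⟨_, rfl⟩

theorem component_subset {S : List ℕ} {v u : ℕ} (h : u ∈ component E S v) : u ∈ verts E := by
  obtain ⟨p, hp⟩ := exists_component_eq_filter (E := E) S v
  rw [hp] at h
  exact (List.mem_filter.1 h).1

theorem component_congr {S S' : List ℕ} {v : ℕ} (hv : v ∈ verts E)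
    (h : ∀ u, Reach E S v u ↔ Reach E S' v u) : component E S v = component E S' v := by
  obtain ⟨p, hp⟩ := exists_component_eq_filter (E := E) S v
  obtain ⟨p', hp'⟩ := exists_component_eq_filter (E := E) S' v
  rw [hp, hp']
  refine List.filter_congr fun u hu => ?_
  have h1 := (mem_component (S := S) (u := u) hv).trans (h u)
  rw [← mem_component hv, hp, hp', List.mem_filter, List.mem_filter] at h1
  rw [Bool.eq_iff_iff]
  exact ⟨fun h => (h1.1 ⟨hu, h⟩).2, fun h => (h1.2 ⟨hu, h⟩).2⟩

theorem notMem_of_mem_component {S : List ℕ} {v u : ℕ} (hv : v ∈ verts E) (hS : v ∉ S)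
    (h : u ∈ component E S v) : u ∉ S := by
  have h := (mem_component hv).1 h
  cases h with
  | refl => exact hS
  | tail _ h => exact h.2

/-- `u` is a neighbour of `C` outside `C`. -/
def IsBoundary (E : List (List ℕ)) (C : List ℕ) (u : ℕ) : Prop :=
  u ∉ C ∧ ∃ w ∈ C, Adjacent E w u

theorem isNbr_iff {C : List ℕ} {u : ℕ} : isNbr E C u = true ↔ IsBoundary E C u := by
  simp [isNbr, touches_iff, IsBoundary]

/-- A neighbour outside `S` would itself be reached and so belong to the component. -/
theorem IsBoundary.mem {S : List ℕ} {v u : ℕ} (hv : v ∈ verts E)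
    (h : IsBoundary E (component E S v) u) : u ∈ S := by
  by_contra hS
  obtain ⟨h1, w, hw, h2⟩ := h
  exact h1 ((mem_component hv).2 (((mem_component hv).1 hw).tail ⟨h2, hS⟩))

theorem goodBag_iff {T : List (List ℕ)} {C B : List ℕ} : goodBag E T C B = true ↔
    (∀ u, IsBoundary E C u → u ∈ B) ∧ (∀ u ∈ B, u ∈ C ∨ IsBoundary E C u) ∧
      (∃ u ∈ C, u ∈ B) ∧ ∀ v ∈ C, v ∉ B → component E B v ∈ T := by
  have h : (∀ u ∈ verts E, ¬ IsBoundary E C u ∨ u ∈ B) ↔ ∀ u, IsBoundary E C u → u ∈ B := by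
    refine ⟨fun h u hu => ?_, fun h u _ => ?_⟩
    · obtain ⟨w, -, ha⟩ := hu.2
      exact (h u ha.mem_verts).resolve_left (not_not.2 hu)
    · by_cases hu : IsBoundary E C u
      · exact .inr (h u hu)
      · exact .inl hu
  rw [← h]
  simp only [goodBag, Bool.and_eq_true, List.all_eq_true, List.any_eq_true, Bool.or_eq_true,
    decide_eq_true_eq, Bool.not_eq_true', ← Bool.not_eq_true, isNbr_iff, and_assoc]
  refine and_congr_right fun _ => and_congr_right fun _ => and_congr_right fun _ => ?_
  exact forall_congr' fun v => forall_congr' fun _ => by tauto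

/-- The first vertex of a path outside `C` would be a boundary vertex, hence in `B`. So a path
avoiding `B` stays in `C`, where it also avoids `U`. -/
theorem reach_of_boundary_subset {B U C : List ℕ} {v u : ℕ} (hC : ∀ u ∈ C, u ∉ U)
    (hN : ∀ u, IsBoundary E C u → u ∈ B) (hv : v ∈ C) (h : Reach E B v u) :
    u ∈ C ∧ Reach E (B ++ U) v u := by
  induction h with
  | refl => exact ⟨hv, .refl⟩
  | @tail x y _ h ih =>
    have hy : y ∈ C := by
      by_contra hy
      exact h.2 (hN y ⟨hy, x, ih.1, h.1⟩)
    exact ⟨hy, ih.2.tail ⟨h.1, by simp [h.2, hC y hy]⟩⟩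

theorem Reach.mono {S S' : List ℕ} (h : ∀ x ∈ S, x ∈ S') {v u : ℕ} (hr : Reach E S' v u) :
    Reach E S v u :=
  Relation.ReflTransGen.mono (fun _ _ hxy => ⟨hxy.1, fun hS => hxy.2 (h _ hS)⟩) _ _ hr

/-- Inside `C`, the components of the complement of `B ∪ U` are those of the complement of `B`. -/
theorem component_append_of_mem {B U : List ℕ} {v₀ v : ℕ} (hv₀ : v₀ ∈ verts E) (hU : v₀ ∉ U)
    (hN : ∀ u, IsBoundary E (component E U v₀) u → u ∈ B) (hv : v ∈ component E U v₀) :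
    component E (B ++ U) v = component E B v :=
  component_congr (component_subset hv) fun u =>
    ⟨Reach.mono (by simp +contextual), fun h => (reach_of_boundary_subset
      (fun _ h => notMem_of_mem_component hv₀ hU h) hN hv h).2⟩

/-- The boundary of the component of `v₀` lies in `U`, so `B` removes, beyond `U`, only vertices of
that component; paths from elsewhere that avoid `U` never enter it. -/
theorem component_append_of_notMem {B U : List ℕ} {v₀ v : ℕ} (hv₀ : v₀ ∈ verts E)
    (hB : ∀ u ∈ B, u ∈ component E U v₀ ∨ IsBoundary E (component E U v₀) u)
    (hv : v ∈ verts E) (hvU : v ∉ U) (hvC : v ∉ component E U v₀) :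
    component E (B ++ U) v = component E U v := by
  refine component_congr hv fun u => ⟨Reach.mono (by simp +contextual), fun h => ?_⟩
  have key : u ∉ U ∧ u ∉ component E U v₀ ∧ Reach E (B ++ U) v u := by
    induction h with
    | refl => exact ⟨hvU, hvC, .refl⟩
    | @tail x y _ h ih =>
      have hy : y ∉ component E U v₀ := fun hy =>
        ih.1 (IsBoundary.mem hv₀ ⟨ih.2.1, y, hy, h.1.symm⟩)
      refine ⟨h.2, hy, ih.2.2.tail ⟨h.1, ?_⟩⟩
      rw [List.mem_append, not_or]
      exact ⟨fun hyB => (hB y hyB).elim hy fun hn => h.2 (hn.mem hv₀), h.2⟩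
  exact key.2.2

/-! ### Soundness of the greedy decomposition -/

/-- Lists of bags, from the last to the first, with the running intersection property, where every
bag but the first, empty one has a new vertex. -/
inductive RunningIntersection : List Bag → Prop
  | base : RunningIntersection [([], [])]
  | step {L : List Bag} {B : Bag} : RunningIntersection L →
      (∃ B' ∈ L, ∀ x ∈ B.1, x ∈ covered L → x ∈ B'.1) → (∃ x ∈ B.1, x ∉ covered L) →
      RunningIntersection (B :: L)

/-- The invariant of the greedy construction. -/
structure IsPartial (E : List (List ℕ)) (BB L : List Bag) : Prop where
  ri : RunningIntersection L
  mem : ∀ B ∈ L, B = ([], []) ∨ B ∈ BB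
  verts : ∀ B ∈ L, ∀ x ∈ B.1, x ∈ verts E
  edges : ∀ e ∈ E, (∃ x ∈ e, x ∉ covered L) ∨ ∃ B ∈ L, ∀ x ∈ e, x ∈ B.1
  boundary : ∀ v ∈ TreeProj.verts E, v ∉ covered L →
    ∃ B ∈ L, ∀ u, IsBoundary E (component E (covered L) v) u → u ∈ B.1

/-- The initial empty bag hosts the empty hyperedges and the empty boundaries of the connected
components. -/
theorem IsPartial.init (BB : List Bag) : IsPartial E BB [([], [])] where
  ri := .base
  mem := by simp
  verts := by simp
  edges e _ := by
    cases e with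
    | nil => exact .inr ⟨_, List.mem_singleton_self _, by simp⟩
    | cons x e => exact .inl ⟨x, by simp, by simp [covered]⟩
  boundary v hv _ := ⟨_, List.mem_singleton_self _, fun u hu => by
    simpa [covered] using hu.mem hv⟩

theorem covered_cons (B : Bag) (L : List Bag) : covered (B :: L) = B.1 ++ covered L := rfl

theorem mem_nextBags {T : List (List ℕ)} {BB L : List Bag} {B : Bag} :
    B ∈ nextBags E BB T L ↔ ∃ v ∈ verts E, v ∉ covered L ∧ B ∈ BB ∧
      goodBag E T (component E (covered L) v) B.1 = true := by
  simp [nextBags, and_assoc]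

/-- Let `C` be the component for which `B` is good. The old vertices of `B` lie on the boundary of
`C`, hence in one earlier bag, and `B` has a new vertex because it meets `C`. Components left inside
`C` have their boundary in `B`; the other components do not change. -/
theorem IsPartial.cons {T : List (List ℕ)} {BB L : List Bag} {B : Bag} (h : IsPartial E BB L)
    (hB : B ∈ nextBags E BB T L) : IsPartial E BB (B :: L) := by
  obtain ⟨v₀, hv₀, hU, hBB, hg⟩ := mem_nextBags.1 hB
  obtain ⟨g1, g2, ⟨w, hwC, hwB⟩, -⟩ := goodBag_iff.1 hg
  have hCU : ∀ u ∈ component E (covered L) v₀, u ∉ covered L := fun u hu =>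
    notMem_of_mem_component hv₀ hU hu
  constructor
  · refine .step h.ri ?_ ⟨w, hwB, hCU w hwC⟩
    obtain ⟨B', hB', hb⟩ := h.boundary v₀ hv₀ hU
    exact ⟨B', hB', fun x hx hxU => (g2 x hx).elim (fun hc => absurd hxU (hCU x hc)) (hb x)⟩
  · intro B' hB'
    rcases List.mem_cons.1 hB' with rfl | hB'
    · exact .inr hBB
    · exact h.mem B' hB'
  · intro B' hB' x hx
    rcases List.mem_cons.1 hB' with rfl | hB'
    · rcases g2 x hx with hc | ⟨-, w, -, ha⟩
      · exact component_subset hc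
      · exact ha.mem_verts
    · exact h.verts B' hB' x hx
  · intro e he
    rw [covered_cons]
    by_cases hnew : ∃ x ∈ e, x ∉ B.1 ++ covered L
    · exact .inl hnew
    · refine .inr ?_
      -- A hyperedge that has just become covered contains a vertex `x` of `C`. Each of its vertices
      -- is then in `C` or on its boundary, and in both cases in `B`.
      rcases h.edges e he with ⟨x, hx, hxU⟩ | ⟨B', hB', h'⟩
      · push Not at hnew
        have hmem : ∀ y ∈ e, y ∉ covered L → y ∈ B.1 := fun y hy hyU =>
          (List.mem_append.1 (hnew y hy)).resolve_right hyU
        have hxC : x ∈ component E (covered L) v₀ :=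
          (g2 x (hmem x hx hxU)).resolve_right fun hn => hxU (hn.mem hv₀)
        refine ⟨B, by simp, fun y hy => ?_⟩
        by_cases hyC : y ∈ component E (covered L) v₀
        · exact hmem y hy (hCU y hyC)
        · exact g1 y ⟨hyC, x, hxC, e, he, hx, hy⟩
      · exact ⟨B', by simp [hB'], h'⟩
  · intro v hv hvU
    rw [covered_cons] at hvU ⊢
    have hvU' := List.mem_append.not.1 hvU
    push Not at hvU'
    by_cases hvC : v ∈ component E (covered L) v₀
    · rw [component_append_of_mem hv₀ hU g1 hvC]
      exact ⟨B, by simp, fun u hu => hu.mem hv⟩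
    · rw [component_append_of_notMem hv₀ g2 hv hvU'.2 hvC]
      obtain ⟨B', hB', hb⟩ := h.boundary v hv hvU'.2
      exact ⟨B', by simp [hB'], hb⟩

theorem extend_cases (E T : List (List ℕ)) (BB L : List Bag) :
    (nextBags E BB T L = [] ∧ extend E BB T L = L) ∨
      ∃ B ∈ nextBags E BB T L, extend E BB T L = B :: L := by
  unfold extend
  cases h : nextBags E BB T L with
  | nil => exact .inl ⟨rfl, rfl⟩
  | cons B l => exact .inr ⟨B, by simp, rfl⟩

theorem iterate_induction {σ : Type*} {f : σ → σ} {K : σ → Prop} (h : ∀ s, K s → K (f s)) (n : ℕ)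
    {s : σ} (hs : K s) : K (f^[n] s) := by
  induction n generalizing s with
  | zero => exact hs
  | succ n ih => exact ih (h s hs)

theorem isPartial_decomposition (E : List (List ℕ)) (BB : List Bag) :
    IsPartial E BB (decomposition E BB) := by
  refine iterate_induction (K := IsPartial E BB) (fun L hL => ?_) _ (IsPartial.init BB)
  rcases extend_cases E (solvable E BB) BB L with ⟨-, h⟩ | ⟨B, hB, h⟩
  · rw [h]; exact hL
  · rw [h]; exact hL.cons hB

theorem isComplete_iff {BB L : List Bag} :
    isComplete E BB L = true ↔ BB ≠ [] ∧ ∀ v ∈ verts E, v ∈ covered L := by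
  cases BB <;> simp [isComplete]

/-- Every successful extension covers a new vertex, so the rounds performed suffice to get stuck. -/
theorem nextBags_decomposition (E : List (List ℕ)) (BB : List Bag) :
    nextBags E BB (solvable E BB) (decomposition E BB) = [] := by
  refine iterate_reaches (fun L => ((verts E).filter fun u => decide (u ∉ covered L)).length)
    (fun L => nextBags E BB (solvable E BB) L = []) (fun L => ?_) (fun L hL => ?_)
    (List.length_filter_le _ _)
  · rcases extend_cases E (solvable E BB) BB L with ⟨h, -⟩ | ⟨B, hB, h⟩
    · exact .inl h
    · right
      obtain ⟨v₀, hv₀, hU, hBB, hg⟩ := mem_nextBags.1 hB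
      obtain ⟨g1, g2, ⟨w, hwC, hwB⟩, -⟩ := goodBag_iff.1 hg
      rw [h, covered_cons]
      refine length_filter_lt (x := w) (fun x _ hx => ?_) (component_subset hwC) ?_ ?_
      · simp only [decide_eq_true_eq, List.mem_append] at hx ⊢; tauto
      · simpa using notMem_of_mem_component hv₀ hU hwC
      · simp [hwB]
  · rcases extend_cases E (solvable E BB) BB L with ⟨h, h'⟩ | ⟨B, hB, h⟩
    · rw [h', h]
    · rw [hL] at hB; simp at hB

/-- A round of pruning either changes nothing or shortens the list, so `solvable` is a fixed point.
-/
theorem exists_goodBag_of_mem_solvable {BB : List Bag} {C : List ℕ} (h : C ∈ solvable E BB) :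
    ∃ B ∈ BB, goodBag E (solvable E BB) C B.1 = true := by
  have key : prune E BB (solvable E BB) = solvable E BB := by
    refine iterate_reaches List.length (fun T => prune E BB T = T) (fun T => ?_) (fun T hT => ?_)
      le_rfl
    · by_cases h : (prune E BB T).length = T.length
      · exact .inl (List.filter_sublist.eq_of_length h)
      · exact .inr (lt_of_le_of_ne (List.length_filter_le _ _) h)
    · rw [hT, hT]
  rw [← key] at h
  simpa using (List.mem_filter.1 h).2

/-- If every connected component is solvable, then the decomposition is complete. -/
theorem covered_decomposition {BB : List Bag}
    (h : ∀ v ∈ verts E, component E [] v ∈ solvable E BB) {v : ℕ} (hv : v ∈ verts E) :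
    v ∈ covered (decomposition E BB) := by
  have key : ∀ v ∈ verts E, v ∉ covered (decomposition E BB) →
      component E (covered (decomposition E BB)) v ∈ solvable E BB := by
    refine iterate_induction (K := fun L => ∀ v ∈ verts E, v ∉ covered L →
      component E (covered L) v ∈ solvable E BB) (fun L hL => ?_) _ fun v hv _ => h v hv
    rcases extend_cases E (solvable E BB) BB L with ⟨-, h⟩ | ⟨B, hB, h⟩
    · rw [h]; exact hL
    · rw [h, covered_cons]
      intro v hv hvU
      obtain ⟨v₀, hv₀, hU, hBB, hg⟩ := mem_nextBags.1 hB
      obtain ⟨g1, g2, -, g4⟩ := goodBag_iff.1 hg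
      have hvU' := List.mem_append.not.1 hvU
      push Not at hvU'
      by_cases hvC : v ∈ component E (covered L) v₀
      · rw [component_append_of_mem hv₀ hU g1 hvC]
        exact g4 v hvC hvU'.1
      · rw [component_append_of_notMem hv₀ g2 hv hvU'.2 hvC]
        exact hL v hv hvU'.2
  by_contra hU
  obtain ⟨B, hB, hg⟩ := exists_goodBag_of_mem_solvable (key v hv hU)
  have := mem_nextBags.2 ⟨v, hv, hU, hB, hg⟩
  rw [nextBags_decomposition] at this
  simp at this

/-! ### Completeness of the greedy decomposition -/

/-- A sequence of bags with the running intersection property: `par i` is the index of an earlier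
bag that contains the common vertices of the bag `i` and the earlier bags. -/
structure BagSequence where
  bag : ℕ → Set ℕ
  par : ℕ → ℕ
  par_lt : ∀ i, 0 < i → par i < i
  mem_par : ∀ i, 0 < i → ∀ x ∈ bag i, ∀ j < i, x ∈ bag j → x ∈ bag (par i)

namespace BagSequence

variable (D : BagSequence)

/-- `s` is `t` or an ancestor of `t`. -/
def Anc : ℕ → ℕ → Prop := Relation.ReflTransGen fun t s => 0 < t ∧ s = D.par t

/-- The index of the first bag that contains `x`. -/
noncomputable def first (x : ℕ) : ℕ := sInf {i | x ∈ D.bag i}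

variable {D}

theorem first_le {x i : ℕ} (h : x ∈ D.bag i) : D.first x ≤ i := Nat.sInf_le h

theorem mem_first {x i : ℕ} (h : x ∈ D.bag i) : x ∈ D.bag (D.first x) :=
  Nat.sInf_mem (s := {i | x ∈ D.bag i}) ⟨i, h⟩

theorem Anc.le {t s : ℕ} (h : D.Anc t s) : s ≤ t := by
  induction h with
  | refl => exact le_rfl
  | @tail x y _ h ih => exact (h.2 ▸ (D.par_lt x h.1).le).trans ih

/-- On the way up from `t` to `s` every parent still has index at least `j`, so the running
intersection property hands `x` on at each step. -/
theorem Anc.mem {t s j x : ℕ} (h : D.Anc t s) (hx : x ∈ D.bag t) (hj : x ∈ D.bag j)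
    (hjs : j ≤ s) : x ∈ D.bag s := by
  induction h with
  | refl => exact hx
  | @tail y z _ h ih =>
    have hlt := D.par_lt y h.1
    rw [h.2] at hjs ⊢
    exact D.mem_par y h.1 x (ih (by omega)) j (by omega) hj

theorem anc_first {t x : ℕ} (h : x ∈ D.bag t) : D.Anc t (D.first x) := by
  induction t using Nat.strong_induction_on with
  | _ t ih =>
    rcases (first_le h).eq_or_lt with h' | h'
    · rw [h']; exact .refl
    · have ht : 0 < t := by omega
      exact .head ⟨ht, rfl⟩ (ih _ (D.par_lt t ht) (D.mem_par t ht x h _ h' (mem_first h)))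

/-- Parents are unique, so the ancestors of `t` form a chain, ordered by their indices. -/
theorem Anc.of_le {t a b : ℕ} (ha : D.Anc t a) (hb : D.Anc t b) (h : a ≤ b) : D.Anc b a := by
  rcases Relation.ReflTransGen.total_of_right_unique
    (fun x y z hy hz => hy.2.trans hz.2.symm) ha hb with h' | h'
  · have := Anc.le h'
    obtain rfl : a = b := by omega
    exact .refl
  · exact h'

/-- The first bags of `x` and `y` and the index `q` all lie on the chain of ancestors of `t`. -/
theorem anc_first_of_adjacent {t x y q : ℕ} (hx : x ∈ D.bag t) (hy : y ∈ D.bag t)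
    (h : D.Anc (D.first x) q) (hq : q ≤ D.first y) : D.Anc (D.first y) q :=
  Anc.of_le ((anc_first hx).trans h) (anc_first hy) hq

/-- A component of the complement of a bag all whose neighbours occur earlier than the component. -/
def IsBlock (D : BagSequence) (E : List (List ℕ)) (BB : List Bag) (C : List ℕ) : Prop :=
  (∃ B ∈ BB, ∃ v ∈ verts E, v ∉ B.1 ∧ C = component E B.1 v) ∧
    ∀ u, IsBoundary E C u → ∀ w ∈ C, D.first u < D.first w

variable {BB : List Bag}

/-- Let `q` be the least index of a bag that meets `C`. Since `C` is connected, `q` is an ancestor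
of every bag that meets `C`. A boundary vertex lies in such a bag and, `C` being a block, also in a
bag before `q`, hence in the bag `q`. Once that bag is taken, the pieces of `C` have boundary
vertices that appear no later than `q`, while their own vertices appear after `q`. -/
theorem IsBlock.exists_bag (hcov : ∀ e ∈ E, ∃ i, ∀ x ∈ e, x ∈ D.bag i)
    (hBB : ∀ i, ∀ S ⊆ D.bag i, ∃ B ∈ BB, ∀ x, x ∈ B.1 ↔ x ∈ S) {C : List ℕ}
    (hC : D.IsBlock E BB C) : ∃ B ∈ BB, (∀ u, IsBoundary E C u → u ∈ B.1) ∧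
      (∀ u ∈ B.1, u ∈ C ∨ IsBoundary E C u) ∧ (∃ u ∈ C, u ∈ B.1) ∧
      ∀ v ∈ C, v ∉ B.1 → D.IsBlock E BB (component E B.1 v) := by
  obtain ⟨⟨B₀, hB₀, v₀, hv₀, hv₀B, rfl⟩, hlt⟩ := hC
  set C := component E B₀.1 v₀ with hCdef
  have hv₀C : v₀ ∈ C := (mem_component hv₀).2 .refl
  have hbag : ∀ x ∈ C, ∃ i, x ∈ D.bag i := fun x hx => by
    obtain ⟨e, he, hxe⟩ := mem_verts.1 (component_subset hx)
    obtain ⟨i, hi⟩ := hcov e he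
    exact ⟨i, hi x hxe⟩
  obtain ⟨w₀, hw₀, hmin⟩ : ∃ w₀ ∈ C, ∀ w ∈ C, D.first w₀ ≤ D.first w := by
    obtain ⟨w, hw, hmin⟩ := C.toFinset.exists_min_image D.first ⟨v₀, by simpa using hv₀C⟩
    exact ⟨w, by simpa using hw, fun w' hw' => hmin w' (by simpa using hw')⟩
  set q := D.first w₀ with hq
  have hstep : ∀ x ∈ C, ∀ y ∈ C, Adjacent E x y → D.Anc (D.first x) q → D.Anc (D.first y) q := by
    rintro x hx y hy ⟨e, he, hxe, hye⟩ h
    obtain ⟨i, hi⟩ := hcov e he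
    exact anc_first_of_adjacent (hi x hxe) (hi y hye) h (hmin y hy)
  -- An equivalence is needed: the property is known at `w₀` and must travel back to `v₀` before it
  -- spreads over `C`.
  have hconn : ∀ x, Reach E B₀.1 v₀ x → (D.Anc (D.first v₀) q ↔ D.Anc (D.first x) q) := by
    intro x hx
    induction hx with
    | refl => exact Iff.rfl
    | @tail x y hx h ih =>
      have hxC : x ∈ C := (mem_component hv₀).2 hx
      have hyC : y ∈ C := (mem_component hv₀).2 (hx.tail h)
      exact ih.trans ⟨hstep x hxC y hyC h.1, hstep y hyC x hxC h.1.symm⟩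
  have hanc : ∀ x ∈ C, D.Anc (D.first x) q := fun x hx =>
    (hconn x ((mem_component hv₀).1 hx)).1
      ((hconn w₀ ((mem_component hv₀).1 hw₀)).2 .refl)
  have hbd : ∀ u, IsBoundary E C u → u ∈ D.bag q := by
    intro u hu
    have hlt' := hlt u hu w₀ hw₀
    obtain ⟨-, w, hw, e, he, hwe, hue⟩ := hu
    obtain ⟨i, hi⟩ := hcov e he
    exact Anc.mem ((anc_first (hi w hwe)).trans (hanc w hw)) (hi u hue) (mem_first (hi u hue))
      hlt'.le
  -- Here it matters that `BB` contains all subsets of the bags: the bag `q` is cut down to `C` and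
  -- its boundary.
  obtain ⟨B, hB, hmem⟩ := hBB q {u | u ∈ D.bag q ∧ (u ∈ C ∨ IsBoundary E C u)} fun u hu => hu.1
  simp only [Set.mem_ofPred_eq] at hmem
  have hNB : ∀ u, IsBoundary E C u → u ∈ B.1 := fun u hu => (hmem u).2 ⟨hbd u hu, .inr hu⟩
  obtain ⟨i₀, hi₀⟩ := hbag w₀ hw₀
  refine ⟨B, hB, hNB, fun u hu => ((hmem u).1 hu).2,
    ⟨w₀, hw₀, (hmem w₀).2 ⟨mem_first hi₀, .inl hw₀⟩⟩, fun v hv hvB => ?_⟩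
  have hvV := component_subset hv
  refine ⟨⟨B, hB, v, hvV, hvB, rfl⟩, fun u hu w hw => ?_⟩
  have huq := first_le ((hmem u).1 (hu.mem hvV)).1
  have hwC : w ∈ C := (reach_of_boundary_subset (U := []) (by simp) hNB hv
    ((mem_component hvV).1 hw)).1
  have hqw := hmin w hwC
  -- A vertex of `C` that first appears at `q` lies in `B`, so not in a component of its complement.
  have hne : q ≠ D.first w := fun h => by
    obtain ⟨i, hi⟩ := hbag w hwC
    exact notMem_of_mem_component hvV hvB hw ((hmem w).2 ⟨h ▸ mem_first hi, .inl hwC⟩)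
  omega

/-- Pruning never discards a block, because it has a good bag whose remaining pieces are blocks too.
-/
theorem mem_solvable (hcov : ∀ e ∈ E, ∃ i, ∀ x ∈ e, x ∈ D.bag i)
    (hBB : ∀ i, ∀ S ⊆ D.bag i, ∃ B ∈ BB, ∀ x, x ∈ B.1 ↔ x ∈ S) {C : List ℕ}
    (hC : D.IsBlock E BB C) : C ∈ solvable E BB := by
  have key : ∀ C, D.IsBlock E BB C → C ∈ solvable E BB := by
    refine iterate_induction (K := fun T => ∀ C, D.IsBlock E BB C → C ∈ T) (fun T hT C hC => ?_) _
      fun C hC => ?_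
    · obtain ⟨B, hB, g1, g2, g3, g4⟩ := hC.exists_bag hcov hBB
      exact List.mem_filter.2 ⟨hT C hC, List.any_eq_true.2 ⟨B, hB, goodBag_iff.2
        ⟨g1, g2, g3, fun v hv hvB => hT _ (g4 v hv hvB)⟩⟩⟩
    · obtain ⟨⟨B, hB, v, hv, hvB, rfl⟩, -⟩ := hC
      simp only [allComponents, List.mem_flatMap, List.mem_map, List.mem_filter]
      exact ⟨B, hB, v, ⟨hv, by simpa using hvB⟩, rfl⟩
  exact key C hC

/-- The empty bag belongs to `BB`, and the connected components are the components of its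
complement. Having no boundary, they are blocks. -/
theorem isComplete_decomposition (hcov : ∀ e ∈ E, ∃ i, ∀ x ∈ e, x ∈ D.bag i)
    (hBB : ∀ i, ∀ S ⊆ D.bag i, ∃ B ∈ BB, ∀ x, x ∈ B.1 ↔ x ∈ S) :
    isComplete E BB (decomposition E BB) = true := by
  obtain ⟨B, hB, hmem⟩ := hBB 0 ∅ (Set.empty_subset _)
  have hB1 : B.1 = [] := List.eq_nil_iff_forall_not_mem.2 fun x hx => (hmem x).1 hx
  refine isComplete_iff.2 ⟨fun h => by simp [h] at hB, fun v hv =>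
    covered_decomposition (fun v hv => mem_solvable hcov hBB
      ⟨⟨B, hB, v, hv, by simp [hB1], by rw [hB1]⟩, fun u hu => ?_⟩) hv⟩
  simpa using hu.mem hv

end BagSequence

end

/-! ### Tree decompositions -/

/-- In a tree, the vertices whose labels contain a given node are closed under paths. -/
def PathConvex {ι : Type*} (T : SimpleGraph ι) (χ : ι → Set ℕ) : Prop :=
  ∀ (i j : ι) (p : T.Walk i j), p.IsPath → ∀ x, x ∈ χ i → x ∈ χ j → ∀ k ∈ p.support, x ∈ χ k

/-- Paths in a tree are unique, so the given path is the one that runs inside the induced subgraph.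
-/
theorem pathConvex_of_preconnected {ι : Type*} {T : SimpleGraph ι} (hT : T.IsTree)
    {χ : ι → Set ℕ} (h : ∀ x, (T.induce {i | x ∈ χ i}).Preconnected) : PathConvex T χ := by
  intro i j p hp x hi hj k hk
  obtain ⟨q, hq⟩ := (h x ⟨i, hi⟩ ⟨j, hj⟩).exists_isPath
  have hq' : (q.map (SimpleGraph.Embedding.induce _).toHom).IsPath :=
    SimpleGraph.Walk.IsPath.map (SimpleGraph.Embedding.induce (G := T) _).injective hq
  have heq : p = q.map (SimpleGraph.Embedding.induce _).toHom :=
    congrArg Subtype.val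
      ((hT.isAcyclic.subsingleton_path i j).elim ⟨p, hp⟩ ⟨_, hq'⟩)
  rw [heq] at hk
  obtain ⟨⟨k', hk'⟩, -, rfl⟩ := List.mem_map.1
    (Eq.mp (congrArg (k ∈ ·) (SimpleGraph.Walk.support_map _ q)) hk)
  exact hk'

/-- The bags of a tree decomposition can be ordered so that they have the running intersection
property. -/
theorem exists_bagSequence (n : ℕ) {ι : Type} [Finite ι] (hn : Nat.card ι = n + 1)
    {T : SimpleGraph ι} (hT : T.IsTree) {χ : ι → Set ℕ} (h : PathConvex T χ) :
    ∃ D : BagSequence, (∀ k ≤ n, ∃ i, D.bag k = χ i) ∧ (∀ k > n, D.bag k = ∅) ∧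
      ∀ i, ∃ k ≤ n, D.bag k = χ i := by
  classical
  induction n generalizing ι with
  | zero =>
    obtain ⟨hs, ⟨i₀⟩⟩ := Nat.card_eq_one_iff_unique.1 hn
    refine ⟨⟨fun k => if k = 0 then χ i₀ else ∅, fun _ => 0, fun i hi => hi,
      fun i hi x hx => ?_⟩, fun k hk => ⟨i₀, by simp; omega⟩, fun k hk => by simp; omega,
      fun i => ⟨0, le_rfl, by simp [Subsingleton.elim i i₀]⟩⟩
    simp [hi.ne'] at hx
  | succ n ih =>
    have := Fintype.ofFinite ι
    have : Nontrivial ι := by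
      rw [← Finite.one_lt_card_iff_nontrivial]; omega
    -- A leaf `l` is removed and placed last; its parent is the position of its only neighbour `m`.
    obtain ⟨l, hl⟩ := hT.exists_vert_degree_one_of_nontrivial
    obtain ⟨m, hlm, hm⟩ := SimpleGraph.degree_eq_one_iff_existsUnique_adj.1 hl
    have hT' : (T.induce {l}ᶜ).IsTree :=
      ⟨hT.connected.induce_compl_singleton_of_degree_eq_one hl, hT.isAcyclic.induce _⟩
    have hcard : Nat.card ({l}ᶜ : Set ι) = n + 1 := by
      have := Set.ncard_add_ncard_compl ({l} : Set ι)
      rw [Set.ncard_singleton] at this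
      rw [Nat.card_coe_set_eq]; omega
    have hconv : PathConvex (T.induce {l}ᶜ) fun i => χ i.1 := by
      intro i j p hp x hi hj k hk
      refine h i.1 j.1 (p.map (SimpleGraph.Embedding.induce _).toHom)
        (SimpleGraph.Walk.IsPath.map (SimpleGraph.Embedding.induce (G := T) _).injective hp)
        x hi hj k.1 ?_
      exact Eq.mpr (congrArg (k.1 ∈ ·) (SimpleGraph.Walk.support_map _ p))
        (List.mem_map.2 ⟨k, hk, rfl⟩)
    obtain ⟨D, h1, h2, h3⟩ := ih hcard hT' hconv
    obtain ⟨k₀, hk₀, hbag₀⟩ := h3 ⟨m, fun hml => hlm.ne hml.symm⟩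
    refine ⟨⟨fun k => if k = n + 1 then χ l else D.bag k,
      fun k => if k = n + 1 then k₀ else D.par k, fun i hi => ?_, fun i hi x hx j hj hxj => ?_⟩,
      fun k hk => ?_, fun k hk => ?_, fun i => ?_⟩
    · split
      · omega
      · exact D.par_lt i hi
    · by_cases hi' : i = n + 1
      · subst hi'
        simp only [if_true] at hx ⊢
        rw [if_neg (by omega)] at hxj ⊢
        obtain ⟨j', hj'⟩ := h1 j (by omega)
        rw [hj'] at hxj
        rw [hbag₀]
        -- Every path from `l` to another vertex passes through `m`, so convexity puts `x` into the
        -- bag of `m`.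
        obtain ⟨p, hp⟩ := hT.connected.exists_isPath l j'.1
        have hnil : ¬ p.Nil := SimpleGraph.Walk.not_nil_of_ne fun h => j'.2 h.symm
        have := hm _ (p.adj_snd hnil)
        exact h l j' p hp x hx hxj m (this ▸ p.getVert_mem_support 1)
      · simp only [if_neg hi'] at hx ⊢
        by_cases hin : i ≤ n
        · have := D.par_lt i hi
          rw [if_neg (by omega)] at hxj ⊢
          exact D.mem_par i hi x hx j hj hxj
        · rw [h2 i (by omega)] at hx
          exact absurd hx (Set.notMem_empty _)
    · by_cases hk' : k = n + 1
      · exact ⟨l, if_pos hk'⟩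
      · obtain ⟨i, hi⟩ := h1 k (by omega)
        exact ⟨i, (if_neg hk').trans hi⟩
    · exact (if_neg (by omega)).trans (h2 k (by omega))
    · by_cases hi : i = l
      · exact ⟨n + 1, le_rfl, by simp [hi]⟩
      · obtain ⟨k, hk, hk'⟩ := h3 ⟨i, hi⟩
        exact ⟨k, by omega, (if_neg (by omega)).trans hk'⟩

/-! ### Trees from parent functions -/

section

variable {N : ℕ} {par : ℕ → ℕ}

/-- The graph that joins every number below `N` to its parent. -/
def parentGraph (N : ℕ) (par : ℕ → ℕ) : SimpleGraph (Fin N) :=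
  SimpleGraph.fromRel fun p q => q.1 = par p.1

theorem parentGraph_adj (hpar : ∀ i, 0 < i → i < N → par i < i) {i : ℕ} (h0 : 0 < i)
    (hi : i < N) : (parentGraph N par).Adj ⟨i, hi⟩ ⟨par i, (hpar i h0 hi).trans hi⟩ := by
  refine (SimpleGraph.fromRel_adj _ _ _).2 ⟨fun h => ?_, .inl rfl⟩
  have := hpar i h0 hi
  have := congrArg Fin.val h
  simp at this; omega

/-- Following parents leads to `0`, so the graph is connected. Every edge joins some `i ≠ 0` to its
parent, so there are at most `N - 1` edges. -/
theorem isTree_parentGraph (hN : 0 < N) (hpar : ∀ i, 0 < i → i < N → par i < i)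
    (h0 : par 0 = 0) : (parentGraph N par).IsTree := by
  have hconn : (parentGraph N par).Connected := by
    have key : ∀ i, ∀ hi : i < N, (parentGraph N par).Reachable ⟨i, hi⟩ ⟨0, hN⟩ := by
      intro i
      induction i using Nat.strong_induction_on with
      | _ i ih =>
        intro hi
        rcases Nat.eq_zero_or_pos i with rfl | hpos
        · exact .refl _
        · exact (parentGraph_adj hpar hpos hi).reachable.trans (ih _ (hpar i hpos hi) _)
    have : Nonempty (Fin N) := ⟨⟨0, hN⟩⟩
    exact ⟨fun i j => (key i.1 i.2).trans (key j.1 j.2).symm⟩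
  refine SimpleGraph.isTree_iff_connected_and_card.2 ⟨hconn, ?_⟩
  have h1 := hconn.card_vert_le_card_edgeSet_add_one
  have hpar' : ∀ i : Fin N, par i.1 < N := fun i => by
    rcases Nat.eq_zero_or_pos i.1 with h | h
    · rw [h, h0]; exact hN
    · exact (hpar i.1 h i.2).trans i.2
  have hsub : (parentGraph N par).edgeSet ⊆
      (fun i : Fin N => s(i, ⟨par i.1, hpar' i⟩)) '' {⟨0, hN⟩}ᶜ := by
    have key : ∀ p q : Fin N, p ≠ q → q.1 = par p.1 →
        s(p, q) ∈ (fun i : Fin N => s(i, ⟨par i.1, hpar' i⟩)) '' {⟨0, hN⟩}ᶜ := by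
      intro p q hne h
      refine ⟨p, fun hp => hne ?_, ?_⟩
      · rw [Set.mem_singleton_iff] at hp
        subst hp
        exact Fin.ext (by rw [h]; exact h0.symm)
      · have : q = ⟨par p.1, hpar' p⟩ := Fin.ext h
        simp only [this]
    intro e he
    induction e using Sym2.ind with
    | _ p q =>
      obtain ⟨hne, h | h⟩ := (SimpleGraph.fromRel_adj _ _ _).1
        ((SimpleGraph.mem_edgeSet (parentGraph N par)).1 he)
      · exact key p q hne h
      · rw [Sym2.eq_swap]
        exact key q p hne.symm h
  have h2 := (Set.ncard_le_ncard hsub (Set.toFinite _)).trans (Set.ncard_image_le (Set.toFinite _))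
  have h3 := Set.ncard_add_ncard_compl ({⟨0, hN⟩} : Set (Fin N))
  rw [Set.ncard_singleton] at h3
  rw [← Nat.card_coe_set_eq] at h2
  omega

/-- Climbing from any index whose bag contains `x` stays among such indices until the least one is
reached. -/
theorem preconnected_parentGraph (hpar : ∀ i, 0 < i → i < N → par i < i) {χ : ℕ → Set ℕ}
    (hχ : ∀ i, 0 < i → i < N → ∀ x ∈ χ i, ∀ j < i, x ∈ χ j → x ∈ χ (par i)) (x : ℕ) :
    ((parentGraph N par).induce {p | x ∈ χ p.1}).Preconnected := by
  classical
  rintro ⟨p, hp⟩ ⟨q, hq⟩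
  have hex : ∃ i, i < N ∧ x ∈ χ i := ⟨p.1, p.2, hp⟩
  have hmin : ∀ j < Nat.find hex, x ∉ χ j := fun j hj hx =>
    Nat.find_min hex hj ⟨hj.trans (Nat.find_spec hex).1, hx⟩
  have key : ∀ i, ∀ hi : i < N, ∀ hx : x ∈ χ i,
      ((parentGraph N par).induce {p : Fin N | x ∈ χ p.1}).Reachable ⟨⟨i, hi⟩, hx⟩
        ⟨⟨Nat.find hex, (Nat.find_spec hex).1⟩, (Nat.find_spec hex).2⟩ := by
    intro i
    induction i using Nat.strong_induction_on with
    | _ i ih =>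
      intro hi hx
      rcases lt_trichotomy i (Nat.find hex) with h | h | h
      · exact absurd hx (hmin i h)
      · subst h; exact .refl _
      · have hpos : 0 < i := by omega
        have hx' := hχ i hpos hi x hx _ h (Nat.find_spec hex).2
        refine .trans (SimpleGraph.Adj.reachable ?_)
          (ih _ (hpar i hpos hi) ((hpar i hpos hi).trans hi) hx')
        exact parentGraph_adj hpar hpos hi
  exact (key p.1 p.2 hp).trans (key q.1 q.2 hq).symm

end

/-! ### Numbering the bags -/

/-- A numbered bag with the number of its parent. -/
abbrev NumberedBag : Type := ℕ × ℕ × List ℕ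

/-- The next number. -/
def nextNumber (R : List NumberedBag) : ℕ := R.casesOn 0 fun e _ => e.1 + 1

/-- The possible parents of the bag `B`. -/
def parents (B : List ℕ) (R : List NumberedBag) : List NumberedBag :=
  R.filter fun e => B.all fun x =>
    !decide (x ∈ (R.map fun e' => e'.2.2).flatten) || decide (x ∈ e.2.2)

/-- Add a bag. -/
def addBag (R : List NumberedBag) (B : Bag) : List NumberedBag :=
  (nextNumber R, (parents B.1 R).casesOn 0 fun e _ => e.1, B.1) :: R

/-- Number the bags of a decomposition, starting from the end of the list. -/
def number (L : List Bag) : List NumberedBag := L.reverse.foldl addBag []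

/-- The bag with the number `i`. -/
def bagAt (L : List Bag) (i : ℕ) : List ℕ := (L.reverse.getD i ([], [])).1

theorem number_cons (B : Bag) (L : List Bag) : number (B :: L) = addBag (number L) B := by
  simp [number]

theorem bagAt_cons_of_lt {B : Bag} {L : List Bag} {i : ℕ} (h : i < L.length) :
    bagAt (B :: L) i = bagAt L i := by
  rw [bagAt, bagAt, List.reverse_cons, List.getD_append _ _ _ _ (by simpa using h)]

theorem bagAt_cons_length (B : Bag) (L : List Bag) : bagAt (B :: L) L.length = B.1 := by
  rw [bagAt, List.reverse_cons, List.getD_append_right _ _ _ _ (by simp)]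
  simp

theorem bagAt_mem {L : List Bag} {i : ℕ} (h : i < L.length) : ∃ B ∈ L, bagAt L i = B.1 := by
  refine ⟨L.reverse[i]'(by simpa using h), ?_, ?_⟩
  · exact List.mem_reverse.1 (List.getElem_mem _)
  · rw [bagAt, List.getD_eq_getElem _ _ (by simpa using h)]

theorem exists_bagAt_eq {L : List Bag} {B : Bag} (h : B ∈ L) : ∃ i < L.length, bagAt L i = B.1 := by
  obtain ⟨i, hi, rfl⟩ := List.mem_iff_getElem.1 (List.mem_reverse.2 h)
  exact ⟨i, by simpa using hi, by rw [bagAt, List.getD_eq_getElem _ _ hi]⟩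

theorem mem_covered {L : List Bag} {x : ℕ} : x ∈ covered L ↔ ∃ i < L.length, x ∈ bagAt L i := by
  rw [covered, List.mem_flatten]
  constructor
  · rintro ⟨l, hl, hx⟩
    obtain ⟨B, hB, rfl⟩ := List.mem_map.1 hl
    obtain ⟨i, hi, h⟩ := exists_bagAt_eq hB
    exact ⟨i, hi, h ▸ hx⟩
  · rintro ⟨i, hi, hx⟩
    obtain ⟨B, hB, h⟩ := bagAt_mem hi
    exact ⟨_, List.mem_map.2 ⟨B, hB, rfl⟩, h ▸ hx⟩

/-- The specification of `number`. -/
structure IsNumbering (L : List Bag) (par : ℕ → ℕ) : Prop where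
  pos : 0 < L.length
  number_eq : number L = ((List.range L.length).map fun i => (i, par i, bagAt L i)).reverse
  par_zero : par 0 = 0
  par_lt : ∀ i, 0 < i → i < L.length → par i < i
  mem_par : ∀ i, 0 < i → i < L.length → ∀ x ∈ bagAt L i, ∀ j < i, x ∈ bagAt L j →
    x ∈ bagAt L (par i)
  new : ∀ i, 0 < i → i < L.length → ∃ x ∈ bagAt L i, ∀ j < i, x ∉ bagAt L j

/-- The running intersection property says that the search for a parent succeeds. Only the first bag
finds none, and the default `0` makes it its own parent. -/
theorem RunningIntersection.exists_isNumbering {L : List Bag} (h : RunningIntersection L) :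
    ∃ par, IsNumbering L par := by
  induction h with
  | base =>
    refine ⟨fun _ => 0, by simp, ?_, rfl, fun i h0 h1 => h0, fun i h0 h1 => ?_, fun i h0 h1 => ?_⟩
    · simp [number, addBag, nextNumber, parents, bagAt]
    · simp at h1; omega
    · simp at h1; omega
  | @step L B hL hB hnew ih =>
    obtain ⟨par, ih⟩ := ih
    have hmem : ∀ e, e ∈ number L ↔ ∃ i < L.length, e = (i, par i, bagAt L i) := by
      intro e
      rw [ih.number_eq]
      simp [eq_comm]
    have hcov : ∀ x, x ∈ ((number L).map fun e' => e'.2.2).flatten ↔ x ∈ covered L := by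
      intro x
      rw [mem_covered]
      simp only [List.mem_flatten, List.mem_map, hmem]
      constructor
      · rintro ⟨_, ⟨_, ⟨i, hi, rfl⟩, rfl⟩, hx⟩
        exact ⟨i, hi, hx⟩
      · rintro ⟨i, hi, hx⟩
        exact ⟨_, ⟨_, ⟨i, hi, rfl⟩, rfl⟩, hx⟩
    have hparents : ∀ e, e ∈ parents B.1 (number L) ↔ ∃ i < L.length, e = (i, par i, bagAt L i) ∧
        ∀ x ∈ B.1, x ∈ covered L → x ∈ bagAt L i := by
      intro e
      simp only [parents, List.mem_filter, hmem, List.all_eq_true, Bool.or_eq_true,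
        Bool.not_eq_true', decide_eq_false_iff_not, decide_eq_true_eq, hcov]
      constructor
      · rintro ⟨⟨i, hi, rfl⟩, h⟩
        exact ⟨i, hi, rfl, fun x hx hc => (h x hx).resolve_left (not_not.2 hc)⟩
      · rintro ⟨i, hi, rfl, h⟩
        exact ⟨⟨i, hi, rfl⟩, fun x hx => Classical.or_iff_not_imp_left.2 fun hc =>
          h x hx (not_not.1 hc)⟩
    obtain ⟨p, hp, hpar, hBp⟩ : ∃ p < L.length,
        ((parents B.1 (number L)).casesOn 0 fun e _ => e.1 : ℕ) = p ∧
          ∀ x ∈ B.1, x ∈ covered L → x ∈ bagAt L p := by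
      obtain ⟨B', hB', hb⟩ := hB
      obtain ⟨i, hi, hiB⟩ := exists_bagAt_eq hB'
      have hne : (i, par i, bagAt L i) ∈ parents B.1 (number L) :=
        (hparents _).2 ⟨i, hi, rfl, by rw [hiB]; exact hb⟩
      cases hpp : parents B.1 (number L) with
      | nil => rw [hpp] at hne; simp at hne
      | cons e l =>
        obtain ⟨j, hj, rfl, hj'⟩ := (hparents e).1 (by rw [hpp]; simp)
        exact ⟨j, hj, rfl, hj'⟩
    have hnext : nextNumber (number L) = L.length := by
      rw [ih.number_eq]
      obtain ⟨n, hn⟩ : ∃ n, L.length = n + 1 := ⟨L.length - 1, by have := ih.pos; omega⟩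
      rw [hn, List.range_succ]
      simp [nextNumber]
    have hpos := ih.pos
    refine ⟨Function.update par L.length p, by simp, ?_, ?_, fun i h0 hi => ?_,
      fun i h0 hi x hx j hj hxj => ?_, fun i h0 hi => ?_⟩
    · rw [number_cons, addBag, hnext, hpar, List.length_cons, List.range_succ, List.map_append,
        List.reverse_append, ih.number_eq]
      simp only [List.map_cons, List.map_nil, List.reverse_cons, List.reverse_nil, List.nil_append,
        Function.update_self, bagAt_cons_length, List.singleton_append]
      refine congrArg (List.cons _) (congrArg List.reverse (List.map_congr_left fun i hi => ?_))
      have hi' := List.mem_range.1 hi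
      rw [bagAt_cons_of_lt hi', Function.update_of_ne hi'.ne]
    · rw [Function.update_of_ne (by omega), ih.par_zero]
    · rw [List.length_cons] at hi
      by_cases h : i = L.length
      · subst h; rwa [Function.update_self]
      · rw [Function.update_of_ne h]; exact ih.par_lt i h0 (by omega)
    · rw [List.length_cons] at hi
      rw [bagAt_cons_of_lt (by omega)] at hxj
      by_cases h : i = L.length
      · subst h
        rw [bagAt_cons_length] at hx
        rw [Function.update_self, bagAt_cons_of_lt hp]
        exact hBp x hx (mem_covered.2 ⟨j, hj, hxj⟩)
      · have := ih.par_lt i h0 (by omega)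
        rw [Function.update_of_ne h, bagAt_cons_of_lt (by omega)]
        rw [bagAt_cons_of_lt (by omega)] at hx
        exact ih.mem_par i h0 (by omega) x hx j hj hxj
    · rw [List.length_cons] at hi
      by_cases h : i = L.length
      · subst h
        obtain ⟨x, hx, hxc⟩ := hnew
        refine ⟨x, by rwa [bagAt_cons_length], fun j hj hxj => hxc (mem_covered.2 ⟨j, hj, ?_⟩)⟩
        rwa [bagAt_cons_of_lt hj] at hxj
      · obtain ⟨x, hx, hn⟩ := ih.new i h0 (by omega)
        refine ⟨x, by rwa [bagAt_cons_of_lt (by omega)], fun j hj hxj => hn j hj ?_⟩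
        rwa [bagAt_cons_of_lt (by omega)] at hxj

theorem IsNumbering.isTree {L : List Bag} {par : ℕ → ℕ} (h : IsNumbering L par) :
    (parentGraph L.length par).IsTree := isTree_parentGraph h.pos h.par_lt h.par_zero

theorem IsNumbering.preconnected {L : List Bag} {par : ℕ → ℕ} (h : IsNumbering L par) (x : ℕ) :
    ((parentGraph L.length par).induce {p | x ∈ {y | y ∈ bagAt L p.1}}).Preconnected :=
  preconnected_parentGraph (χ := fun i => {y | y ∈ bagAt L i}) h.par_lt
    (fun i h0 hi x hx j hj hxj => h.mem_par i h0 hi x hx j hj hxj) x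

/-- Every bag after the first has a vertex not seen before, so different positions give different
hyperedges, and the tree of parents carries over to the hyperedges. -/
theorem RunningIntersection.isAcyclicHypergraph {L : List Bag} (h : RunningIntersection L)
    {H : Hypergraph ℕ} (hH : H.edgeSet = {e | ∃ B ∈ L, e = {x | x ∈ B.1}}) :
    IsAcyclicHypergraph H := by
  obtain ⟨par, hp⟩ := h.exists_isNumbering
  have hmem : ∀ i : Fin L.length, {x | x ∈ bagAt L i.1} ∈ H.edgeSet := fun i => by
    rw [hH]
    obtain ⟨B, hB, h⟩ := bagAt_mem i.2
    exact ⟨B, hB, by rw [h]⟩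
  have hne : ∀ i j : ℕ, j < L.length → i < j →
      {x | x ∈ bagAt L i} ≠ {x | x ∈ bagAt L j} := fun i j hj hij heq => by
    obtain ⟨x, hx, hn⟩ := hp.new j (by omega) hj
    have hx' : x ∈ {x | x ∈ bagAt L j} := hx
    rw [← heq] at hx'
    exact hn i hij hx'
  let f : Fin L.length → H.edgeSet := fun i => ⟨_, hmem i⟩
  have hf : Function.Bijective f := by
    constructor
    · intro i j hij
      have hij' : {x | x ∈ bagAt L i.1} = {x | x ∈ bagAt L j.1} := congrArg Subtype.val hij
      rcases lt_trichotomy i.1 j.1 with h | h | h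
      · exact absurd hij' (hne _ _ j.2 h)
      · exact Fin.ext h
      · exact absurd hij'.symm (hne _ _ i.2 h)
    · rintro ⟨e, he⟩
      have he' := he
      rw [hH] at he'
      obtain ⟨B, hB, rfl⟩ := he'
      obtain ⟨i, hi, hiB⟩ := exists_bagAt_eq hB
      exact ⟨⟨i, hi⟩, Subtype.ext (by simp only [f, hiB])⟩
  let e := Equiv.ofBijective f hf
  let I := SimpleGraph.Iso.map e (parentGraph L.length par)
  refine ⟨_, I.isTree_iff.1 hp.isTree, fun h₁ h₂ p hpath X hX₁ hX₂ h hh => ?_⟩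
  have hval : ∀ h : H.edgeSet, {x | x ∈ bagAt L (I.symm h).1} = h.1 := fun h =>
    congrArg Subtype.val (e.apply_symm_apply h)
  have hq := SimpleGraph.Walk.IsPath.map (f := I.symm.toHom) I.symm.injective hpath
  have := pathConvex_of_preconnected hp.isTree
    (χ := fun p => {y | y ∈ bagAt L p.1}) hp.preconnected _ _ _ hq X
    (by rw [← hval h₁] at hX₁; exact hX₁) (by rw [← hval h₂] at hX₂; exact hX₂) (I.symm h)
    (by rw [SimpleGraph.Walk.support_map]; exact List.mem_map.2 ⟨h, hh, rfl⟩)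
  rw [← hval h]
  exact this

/-! ### Numbering in polynomial time -/

theorem PolyTime.nextNumber : PolyTime nextNumber :=
  list_cases id (const 0) (succ.comp (fst (fst (snd id))))

theorem PolyTime.parents {α : Type} [Enc α] {B : α → List ℕ} {R : α → List NumberedBag}
    (hB : PolyTime B) (hR : PolyTime R) : PolyTime (fun a => parents (B a) (R a)) :=
  filter hR (all hB.onFst (or (not (memNat (snd id)
    (flatten (map hR.onFst.onFst (snd (snd (snd id))))))) (memNat (snd id) (snd (snd (snd (fst id)))))))

theorem sz_incBits_le (l : List Bool) : sz (incBits l) ≤ sz l + 4 := by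
  have ht : sz true = 3 := rfl
  have hf : sz false = 1 := rfl
  induction l with
  | nil => simp [incBits, ht]
  | cons b l ih =>
    cases b <;> simp only [incBits, sz_cons, ht, hf] <;> omega

theorem sz_nat_le (n : ℕ) : sz n ≤ 4 * n + 1 := by
  have h : ∀ n : ℕ, sz n = sz n.bits := fun _ => rfl
  induction n with
  | zero => simp [h]
  | succ n ih =>
    have := sz_incBits_le n.bits
    rw [h, bits_succ]
    rw [h] at ih
    omega

/-- Stated for arbitrary lists of bags, since running times must be bounded on all inputs. -/
theorem number_bounds (L : List Bag) : (number L).length = L.length ∧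
    ∀ e ∈ number L, e.1 < L.length ∧ e.2.1 ≤ L.length ∧ ∃ B ∈ L, e.2.2 = B.1 := by
  induction L with
  | nil => simp [number]
  | cons B L ih =>
    obtain ⟨ih₁, ih₂⟩ := ih
    have h1 : nextNumber (number L) ≤ L.length := by
      cases h : number L with
      | nil => simp [nextNumber]
      | cons e l => exact (ih₂ e (by simp [h])).1
    have h2 : ((parents B.1 (number L)).casesOn 0 fun e _ => e.1 : ℕ) ≤ L.length := by
      cases h : parents B.1 (number L) with
      | nil => simp
      | cons e l =>
        have he : e ∈ parents B.1 (number L) := by simp [h]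
        exact (ih₂ e (List.mem_filter.1 he).1).1.le
    rw [number_cons, addBag]
    refine ⟨by simp [ih₁], fun e he => ?_⟩
    rcases List.mem_cons.1 he with rfl | he
    · exact ⟨by simp; omega, h2.trans (by simp), B, by simp, rfl⟩
    · obtain ⟨h1, h2, B', hB', h3⟩ := ih₂ e he
      exact ⟨by simp; omega, by simp; omega, B', by simp [hB'], h3⟩

theorem sz_number_le (L : List Bag) : sz (number L) ≤ sz L * (10 * sz L + 10) + 1 := by
  obtain ⟨h1, h2⟩ := number_bounds L
  have hlen := length_lt_sz L
  refine (sz_list_le (M := 9 * sz L + 9) fun e he => ?_).trans ?_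
  · obtain ⟨h3, h4, B, hB, h5⟩ := h2 e he
    have h6 := sz_le_of_mem hB
    have h7 : sz B = sz B.1 + sz B.2 + 1 := rfl
    have h8 : sz e = sz e.1 + (sz e.2.1 + sz e.2.2 + 1) + 1 := rfl
    have := sz_nat_le e.1
    have := sz_nat_le e.2.1
    rw [h8, h5]
    omega
  · rw [h1]
    exact Nat.add_le_add_right (Nat.mul_le_mul (by omega) (by omega)) 1

/-- The intermediate results number the initial segments of the reversed list, so the size bound for
`number` applies to each of them. -/
theorem PolyTime.number {α : Type} [Enc α] {L : α → List Bag} (hL : PolyTime L) :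
    PolyTime (fun a => number (L a)) := by
  obtain ⟨Q, hQ, -, hs⟩ := hL.exists_bound
  refine foldl_of_bound (step := fun _ B R => addBag R B) hL.reverse (const [])
    (cons (pair (nextNumber.comp (snd (snd id))) (pair
      (list_cases (g := fun x => x.2.1.1) (parents (fst (fst (snd id))) (snd (snd id))) (const 0)
        (fst (fst (snd id)))) (fst (fst (snd id)))))
      (snd (snd id)))
    (Q := fun n => Q n * (10 * Q n + 10) + 1)
    ((hQ.mul (((PolyBounded.const 10).mul hQ).add (.const 10))).add (.const 1))
    fun a l₁ l₂ h => ?_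
  have h1 := sz_number_le l₁.reverse
  have h2 : sz l₁.reverse ≤ Q (sz a) := by
    refine le_trans (sz_le_of_sublist ?_) (hs a)
    rw [← List.reverse_reverse (L a), h, List.reverse_append]
    exact List.sublist_append_right _ _
  rw [TreeProj.number, List.reverse_reverse] at h1
  exact h1.trans (by gcongr)

/-! ### Enumerating the subsets of the views -/

/-- Decide whether the next vertex of a view belongs to the bag. -/
def branchOnNext (e : Bag × List ℕ) : List (Bag × List ℕ) :=
  e.2.casesOn [e] fun x t => [((x :: e.1.1, e.1.2), t), (e.1, t)]

/-- All bags that are subsets of views. A view is given by a list of vertices and a label. -/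
def subBags (vs : List Bag) : List Bag :=
  ((vs.map fun v => v.1).flatten.foldl (fun L _ => L.flatMap branchOnNext)
    (vs.map fun v => (([], v.2), v.1))).map fun e => e.1

theorem foldl_const_eq_iterate {β γ : Type*} (f : γ → γ) (l : List β) (z : γ) :
    l.foldl (fun z _ => f z) z = f^[l.length] z := by
  induction l generalizing z with
  | nil => rfl
  | cons b l ih => simp [ih]

theorem exists_view_of_mem_subBags {vs : List Bag} {B : Bag} (h : B ∈ subBags vs) :
    ∃ v ∈ vs, B.2 = v.2 ∧ ∀ x ∈ B.1, x ∈ v.1 := by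
  rw [subBags, foldl_const_eq_iterate, List.mem_map] at h
  obtain ⟨e, he, rfl⟩ := h
  have key : ∀ e ∈ (fun L : List (Bag × List ℕ) => L.flatMap branchOnNext)^[
      (vs.map fun v => v.1).flatten.length] (vs.map fun v => (([], v.2), v.1)),
      ∃ v ∈ vs, e.1.2 = v.2 ∧ (∀ x ∈ e.1.1, x ∈ v.1) ∧ ∀ x ∈ e.2, x ∈ v.1 := by
    refine iterate_induction (K := fun L : List (Bag × List ℕ) => ∀ e ∈ L,
      ∃ v ∈ vs, e.1.2 = v.2 ∧ (∀ x ∈ e.1.1, x ∈ v.1) ∧ ∀ x ∈ e.2, x ∈ v.1)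
      (fun L hL e he => ?_) _ fun e he => ?_
    · obtain ⟨⟨⟨b, lab⟩, t⟩, he', he⟩ := List.mem_flatMap.1 he
      obtain ⟨v, hv, h1, h2, h3⟩ := hL _ he'
      refine ⟨v, hv, ?_⟩
      cases t with
      | nil =>
        obtain rfl : e = ((b, lab), []) := by simpa [branchOnNext] using he
        exact ⟨h1, h2, h3⟩
      | cons x t =>
        have he : e = ((x :: b, lab), t) ∨ e = ((b, lab), t) := by
          simpa [branchOnNext] using he
        have ht : ∀ y ∈ t, y ∈ v.1 := fun y hy => h3 y (by simp [hy])
        rcases he with rfl | rfl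
        · refine ⟨h1, fun y hy => ?_, ht⟩
          rcases List.mem_cons.1 hy with rfl | hy
          · exact h3 _ (by simp)
          · exact h2 y hy
        · exact ⟨h1, h2, ht⟩
    · obtain ⟨v, hv, rfl⟩ := List.mem_map.1 he
      exact ⟨v, hv, rfl, by simp, fun x hx => hx⟩
  obtain ⟨v, hv, h1, h2, -⟩ := key e he
  exact ⟨v, hv, h1, h2⟩

/-- At each undecided vertex, follow the branch that agrees with `S`. Entries with nothing left to
decide pass through unchanged, so surplus rounds do no harm. -/
theorem exists_mem_iterate_branch {S : Set ℕ} (n : ℕ) {L : List (Bag × List ℕ)}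
    {e : Bag × List ℕ} (he : e ∈ L) (hn : e.2.length ≤ n) (h1 : ∀ x ∈ e.1.1, x ∈ S)
    (h2 : ∀ x ∈ S, x ∈ e.1.1 ∨ x ∈ e.2) :
    ∃ e' ∈ (fun L : List (Bag × List ℕ) => L.flatMap branchOnNext)^[n] L, e'.1.2 = e.1.2 ∧
      ∀ x, x ∈ e'.1.1 ↔ x ∈ S := by
  induction n generalizing L e with
  | zero =>
    have h0 : e.2 = [] := List.length_eq_zero_iff.1 (by omega)
    refine ⟨e, he, rfl, fun x => ⟨h1 x, fun hx => (h2 x hx).resolve_right (by simp [h0])⟩⟩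
  | succ n ih =>
    rw [Function.iterate_succ_apply]
    have hstep : ∀ e' ∈ branchOnNext e, e' ∈ L.flatMap branchOnNext := fun e' he' =>
      List.mem_flatMap.2 ⟨e, he, he'⟩
    obtain ⟨⟨b, lab⟩, t⟩ := e
    cases t with
    | nil => exact ih (e := ((b, lab), [])) (hstep _ (by simp [branchOnNext])) (by simp) h1 h2
    | cons x t =>
      by_cases hx : x ∈ S
      · refine ih (e := ((x :: b, lab), t)) (hstep _ (by simp [branchOnNext])) (by simpa using hn)
          (fun y hy => ?_) fun y hy => ?_
        · rcases List.mem_cons.1 hy with rfl | hy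
          · exact hx
          · exact h1 y hy
        · have := h2 y hy
          simp only [List.mem_cons] at this ⊢
          tauto
      · refine ih (e := ((b, lab), t)) (hstep _ (by simp [branchOnNext])) (by simpa using hn) h1
          fun y hy => ?_
        rcases h2 y hy with h | h
        · exact .inl h
        · rcases List.mem_cons.1 h with rfl | h
          · exact absurd hy hx
          · exact .inr h

theorem exists_mem_subBags {vs : List Bag} {v : Bag} (hv : v ∈ vs) {S : Set ℕ}
    (hS : ∀ x ∈ S, x ∈ v.1) : ∃ B ∈ subBags vs, B.2 = v.2 ∧ ∀ x, x ∈ B.1 ↔ x ∈ S := by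
  rw [subBags, foldl_const_eq_iterate]
  have hmem : v.1 ∈ vs.map fun v => v.1 := List.mem_map.2 ⟨v, hv, rfl⟩
  -- The number of rounds is the total length of the views, which is at least the length of each.
  obtain ⟨e, he, h1, h2⟩ := exists_mem_iterate_branch (S := S)
    (vs.map fun v => v.1).flatten.length
    (L := vs.map fun v => (([], v.2), v.1)) (e := (([], v.2), v.1))
    (List.mem_map.2 ⟨v, hv, rfl⟩)
    (List.sublist_flatten_of_mem hmem).length_le (by simp)
    fun x hx => .inr (hS x hx)
  exact ⟨e.1, List.mem_map.2 ⟨e, he, rfl⟩, h1, h2⟩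

/-! ### Size and running time of the enumeration of subsets. -/

/-- The number of bags that arise from a list of partially processed views. -/
def weight (L : List (Bag × List ℕ)) : ℕ := (L.map fun e => 2 ^ e.2.length).sum

theorem length_le_weight (L : List (Bag × List ℕ)) : L.length ≤ weight L := by
  induction L with
  | nil => simp
  | cons e L ih =>
    have : 1 ≤ 2 ^ e.2.length := Nat.one_le_two_pow
    simp only [weight, List.map_cons, List.sum_cons, List.length_cons] at ih ⊢
    omega

/-- An entry with `t + 1` undecided vertices splits into two with `t`, and `2 ^ (t + 1)` is twice `2
^ t`. -/
theorem weight_flatMap (L : List (Bag × List ℕ)) :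
    weight (L.flatMap branchOnNext) = weight L := by
  induction L with
  | nil => rfl
  | cons e L ih =>
    simp only [weight, List.flatMap_cons, List.map_append, List.sum_append, List.map_cons,
      List.sum_cons] at ih ⊢
    rw [ih]
    obtain ⟨b, t⟩ := e
    cases t <;> simp [branchOnNext, pow_succ]
    omega

theorem sz_le_of_mem_branch {e e' : Bag × List ℕ} (h : e' ∈ branchOnNext e) : sz e' ≤ sz e := by
  obtain ⟨⟨b, lab⟩, t⟩ := e
  cases t with
  | nil =>
    obtain rfl : e' = ((b, lab), []) := by simpa [branchOnNext] using h
    exact le_rfl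
  | cons x t =>
    have h : e' = ((x :: b, lab), t) ∨ e' = ((b, lab), t) := by simpa [branchOnNext] using h
    rcases h with rfl | rfl <;> simp only [sz_pair, sz_cons] <;> omega

/-- The constant weight bounds the number of entries in every round, and branching does not enlarge
an entry. -/
theorem sz_iterate_branch {vs : List Bag} {K : ℕ} (hK : ∀ v ∈ vs, v.1.length ≤ K) (n : ℕ) :
    sz ((fun L : List (Bag × List ℕ) => L.flatMap branchOnNext)^[n]
      (vs.map fun v => (([], v.2), v.1))) ≤ (sz vs * 2 ^ K) * (sz vs + 3) + 1 := by
  obtain ⟨h1, h2⟩ := iterate_induction (f := fun L : List (Bag × List ℕ) => L.flatMap branchOnNext)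
    (K := fun L => weight L ≤ vs.length * 2 ^ K ∧ ∀ e ∈ L, sz e ≤ sz vs + 2)
    (s := vs.map fun v => (([], v.2), v.1))
    (fun L hL => by
      refine ⟨(weight_flatMap L).trans_le hL.1, fun e he => ?_⟩
      obtain ⟨e', he', h⟩ := List.mem_flatMap.1 he
      exact (sz_le_of_mem_branch h).trans (hL.2 e' he')) n
    (by
      constructor
      · rw [weight, List.map_map, ← smul_eq_mul, ← List.length_map (as := vs)]
        refine List.sum_le_card_nsmul _ _ fun y hy => ?_
        obtain ⟨v, hv, rfl⟩ := List.mem_map.1 hy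
        exact Nat.pow_le_pow_right (by omega) (hK v hv)
      · intro e he
        obtain ⟨v, hv, rfl⟩ := List.mem_map.1 he
        have h1 := sz_le_of_mem hv
        have h2 : sz v = sz v.1 + sz v.2 + 1 := rfl
        simp only [sz_pair, sz_nil]
        omega)
  refine (sz_list_le h2).trans ?_
  have := (length_le_weight _).trans h1
  have h3 : vs.length * 2 ^ K ≤ sz vs * 2 ^ K := Nat.mul_le_mul_right _ (length_lt_sz vs).le
  exact Nat.add_le_add_right (Nat.mul_le_mul_right _ (this.trans h3)) 1

theorem PolyTime.branchOnNext : PolyTime branchOnNext :=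
  list_cases (g := fun x : (Bag × List ℕ) × ℕ × List ℕ =>
      [((x.2.1 :: x.1.1.1, x.1.1.2), x.2.2), (x.1.1, x.2.2)]) (snd id) (cons id (const []))
    (cons (pair (pair (cons (fst (snd id)) (fst (fst (fst id)))) (snd (fst (fst id))))
      (snd (snd id))) (cons (pair (fst (fst id)) (snd (snd id))) (const [])))

theorem TimeIn.subBags {α : Type} [Enc α] {m K : α → ℕ} (hm : ∀ a, sz a ≤ m a)
    (hK : ∀ a, 2 ^ K a ≤ m a) {vs : α → List Bag} (hvs : PolyTime vs)
    (hl : ∀ a, ∀ v ∈ vs a, v.1.length ≤ K a) : TimeIn m (fun a => subBags (vs a)) := by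
  obtain ⟨Q, hQ, hmono, hs⟩ := hvs.exists_bound
  refine PolyTime.comp (g := fun L : List (Bag × List ℕ) => L.map fun e => e.1)
    (PolyTime.map .id (.fst (.snd .id))) (TimeIn.foldl_of_bound hm
    (step := fun _ _ L => L.flatMap TreeProj.branchOnNext)
    ((PolyTime.flatten (hvs.map (.fst (.snd .id)))).timeIn .id hm)
    ((hvs.map (f := fun _ v => (([], v.2), v.1)) (.pair (.pair (.const []) (.snd (.snd .id)))
      (.fst (.snd .id)))).timeIn .id hm)
    (.flatMap (f := fun _ e => TreeProj.branchOnNext e) (.snd (.snd .id))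
      (PolyTime.branchOnNext.comp (PolyTime.snd .id)))
    (Q := fun n => (Q n * n) * (Q n + 3) + 1)
    (((hQ.mul .id).mul (hQ.add (.const 3))).add (.const 1)) fun a l₁ _ _ => ?_)
  rw [foldl_const_eq_iterate]
  refine (sz_iterate_branch (hl a) _).trans ?_
  have h1 := (hs a).trans (hmono (hm a))
  have h2 := hK a
  gcongr

/-- The greedy decomposition succeeds if there is a tree decomposition whose bags are contained in
views. -/
theorem isComplete_of_isTree {ι : Type} [Finite ι] {T : SimpleGraph ι} (hT : T.IsTree)
    {χ : ι → Set ℕ} (hconv : PathConvex T χ) {E : List (List ℕ)} {vs : List Bag}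
    (hE : ∀ e ∈ E, ∃ i, ∀ x ∈ e, x ∈ χ i) (hvs : ∀ i, ∃ v ∈ vs, ∀ x ∈ χ i, x ∈ v.1) :
    isComplete E (subBags vs) (decomposition E (subBags vs)) = true := by
  have : Nonempty ι := hT.connected.nonempty
  obtain ⟨D, h1, h2, h3⟩ := exists_bagSequence (Nat.card ι - 1)
    (by have := Nat.card_pos (α := ι); omega) hT hconv
  have hview : ∀ k, ∃ v ∈ vs, ∀ x ∈ D.bag k, x ∈ v.1 := by
    intro k
    by_cases hk : k ≤ Nat.card ι - 1
    · obtain ⟨i, hi⟩ := h1 k hk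
      rw [hi]; exact hvs i
    · obtain ⟨v, hv, -⟩ := hvs (Classical.arbitrary ι)
      exact ⟨v, hv, by rw [h2 k (by omega)]; simp⟩
  refine D.isComplete_decomposition (fun e he => ?_) fun k S hS => ?_
  · obtain ⟨i, hi⟩ := hE e he
    obtain ⟨k, -, hk⟩ := h3 i
    exact ⟨k, by rw [hk]; exact hi⟩
  · obtain ⟨v, hv, h⟩ := hview k
    obtain ⟨B, hB, -, hB'⟩ := exists_mem_subBags hv (S := S) fun x hx => h x (hS hx)
    exact ⟨B, hB, hB'⟩

/-! ### Queries -/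

/-- The variables of a term. -/
def Term.varList : Term → List ℕ
  | .var X => [X]
  | .const _ => []

/-- The variables of an atom. -/
def Atom.varList (a : Atom) : List ℕ := a.terms.flatMap Term.varList

/-- The hyperedges of a collection of atoms. -/
def edgesOf (A : List Atom) : List (List ℕ) := A.map Atom.varList

theorem Atom.mem_varList {a : Atom} {X : ℕ} : X ∈ a.varList ↔ X ∈ a.vars := by
  simp only [varList, List.mem_flatMap, vars, Set.mem_ofPred_eq]
  constructor
  · rintro ⟨t | t, ht, hX⟩
    · simp only [Term.varList, List.mem_singleton] at hX
      rwa [hX]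
    · simp [Term.varList] at hX
  · exact fun h => ⟨_, h, by simp [Term.varList]⟩

theorem Atom.setOf_varList (a : Atom) : {X | X ∈ a.varList} = a.vars :=
  Set.ext fun _ => Atom.mem_varList

theorem Atom.length_varList_le (a : Atom) : a.varList.length ≤ a.arity := by
  rw [varList, arity]
  induction a.terms with
  | nil => simp
  | cons t l ih =>
    rw [List.flatMap_cons, List.length_append, List.length_cons]
    cases t <;> simp only [Term.varList, List.length_cons, List.length_nil] <;> omega

theorem length_le_maxArity {A : List Atom} {e : List ℕ} (h : e ∈ edgesOf A) :
    e.length ≤ maxArity A := by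
  obtain ⟨a, ha, rfl⟩ := List.mem_map.1 h
  refine a.length_varList_le.trans ?_
  clear h
  induction A with
  | nil => simp at ha
  | cons b A ih =>
    simp only [maxArity, List.map_cons, List.foldr_cons] at ih ⊢
    rcases List.mem_cons.1 ha with rfl | ha
    · exact le_max_left _ _
    · exact (ih ha).trans (le_max_right _ _)

theorem mem_edgeSet_hypergraphOf {A : List Atom} {h : Set ℕ} :
    h ∈ (hypergraphOf A).edgeSet ↔ ∃ e ∈ edgesOf A, h = {X | X ∈ e} := by
  simp [hypergraphOf, edgesOf, Atom.setOf_varList]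

theorem mem_vertexSet_hypergraphOf {A : List Atom} {X : ℕ} :
    X ∈ (hypergraphOf A).vertexSet ↔ X ∈ verts (edgesOf A) := by
  simp [hypergraphOf, edgesOf, mem_verts, Atom.mem_varList]

/-- The constructor and the name of a term. -/
def Term.code : Term → Bool × ℕ
  | .var X => (false, X)
  | .const c => (true, c)

theorem PolyTime.term_varList : PolyTime Term.varList := by
  have h : PolyTime Term.code := cast fun t => by cases t <;> rfl
  convert ite (fst h) (const []) (cons (snd h) (const [])) using 2 with t
  cases t <;> rfl

theorem PolyTime.atom_varList : PolyTime Atom.varList := by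
  have h : PolyTime fun a : Atom => (a.rel, a.terms) := cast fun a => rfl
  exact flatMap (snd h) (term_varList.comp (snd id))

theorem PolyTime.edgesOf {α : Type} [Enc α] {A : α → List Atom} (hA : PolyTime A) :
    PolyTime (fun a => edgesOf (A a)) := map hA (atom_varList.comp (snd id))

/-! ### Fixed-parameter tractability -/

theorem computable_pow_mul (k c : ℕ) : Computable fun n => (3 * 2 ^ (k * n)) ^ c := by
  have hpow : Primrec₂ fun m n : ℕ => m ^ n := Primrec₂.unpaired'.1 Nat.Primrec.pow
  exact (hpow.comp (Primrec.nat_mul.comp (.const 3) (hpow.comp (.const 2)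
    (Primrec.nat_mul.comp (.const k) .id))) (.const c)).to_comp

/-- The measure `m` is positive, so `(m + 2) ^ c ≤ (3 * m) ^ c`, and the power separates into a
factor depending on the parameter and a power of the size. -/
theorem fixedParameterTractable_of_timeIn {P : ParamProblem} [Enc P.Instance]
    (henc : ∀ x, P.encInstance x = enc x) {β : Type} [Enc β] {g : P.Instance → β} (k : ℕ)
    (hg : TimeIn (fun x => 2 ^ (k * P.param x) * sz x) g)
    (hcorrect : ∀ x, P.CorrectAnswer x (enc (g x))) : P.FixedParameterTractable := by
  obtain ⟨c, -, hp⟩ := hg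
  obtain ⟨p, hp⟩ := hp 0
  refine ⟨p, _, c, computable_pow_mul k c, fun x => ⟨_, hcorrect x, ?_⟩⟩
  obtain ⟨s, t, hr, hs, -, ht⟩ := hp x (inputStore (P.encInstance x)) (by simp [inputStore, henc])
  refine ⟨s, t, hr, hs, ht.trans ?_⟩
  have h1 : 1 ≤ 2 ^ (k * P.param x) * sz x := Nat.mul_pos (by positivity) (sz_pos x)
  have h2 : (P.encInstance x).size = sz x := by rw [henc]; rfl
  rw [h2, ← mul_pow, mul_assoc]
  exact Nat.pow_le_pow_left (by dsimp only; omega) c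

theorem sz_le_measure {α : Type} [Enc α] (n : ℕ) (a : α) : sz a ≤ 2 ^ n * sz a :=
  Nat.le_mul_of_pos_left _ (by positivity)

theorem two_pow_le_measure {α : Type} [Enc α] (n : ℕ) (a : α) : 2 ^ n ≤ 2 ^ n * sz a :=
  Nat.le_mul_of_pos_right _ (sz_pos a)

theorem exists_bag_of_isComplete {E : List (List ℕ)} {BB : List Bag}
    (h : isComplete E BB (decomposition E BB) = true) {e : List ℕ} (he : e ∈ E) :
    ∃ B ∈ decomposition E BB, ∀ x ∈ e, x ∈ B.1 := by
  refine ((isPartial_decomposition E BB).edges e he).resolve_left ?_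
  rintro ⟨x, hx, hn⟩
  exact hn ((isComplete_iff.1 h).2 x (mem_verts.2 ⟨e, he, hx⟩))

/-! ### Tree projections -/

/-- The vertices and the bags of a tree projection, if there is one. -/
def treeProjectionOf (E : List (List ℕ)) (BB : List Bag) : Option (List ℕ × List (List ℕ)) :=
  if isComplete E BB (decomposition E BB) then
    some (verts E, (decomposition E BB).map fun B => B.1)
  else none

theorem PolyTime.treeProjectionOf :
    PolyTime (fun x : List (List ℕ) × List Bag => treeProjectionOf x.1 x.2) :=
  ite (isComplete (fst id) (snd id) (decomposition (fst id) (snd id)))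
    (some'.comp (pair (verts (fst id)) (map (decomposition (fst id) (snd id)) (fst (snd id)))))
    (const none)

/-- The views of a collection of atoms. -/
def viewsOf (A : List Atom) : List Bag := (edgesOf A).map fun e => (e, [])

/-- The encodings of `some` and `none` are the two forms of a correct answer. In the negative case,
a join tree of a tree projection would be a tree decomposition with bags inside views, contradicting
completeness of the greedy construction. -/
theorem treeProjection_correct (x : ConjQuery × List Atom) :
    treeProjectionProblem.CorrectAnswer x
      (enc (treeProjectionOf (edgesOf x.1.atoms) (subBags (viewsOf x.2)))) := by
  obtain ⟨Q, V⟩ := x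
  set E := edgesOf Q.atoms with hE
  set BB := subBags (viewsOf V) with hBB
  have hview : ∀ B ∈ BB, ∃ h ∈ (hypergraphOf V).edgeSet, {X | X ∈ B.1} ⊆ h := by
    intro B hB
    obtain ⟨v, hv, -, h⟩ := exists_view_of_mem_subBags hB
    obtain ⟨e, he, rfl⟩ := List.mem_map.1 hv
    exact ⟨_, mem_edgeSet_hypergraphOf.2 ⟨e, he, rfl⟩, h⟩
  by_cases hc : isComplete E BB (decomposition E BB) = true
  · left
    have hpart := isPartial_decomposition E BB
    let H : Hypergraph ℕ :=
      { vertexSet := {X | X ∈ verts E}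
        edgeSet := {h | ∃ e ∈ (decomposition E BB).map fun B => B.1, h = {X | X ∈ e}}
        subset_vertexSet_of_mem_edgeSet' := by
          rintro h ⟨e, he, rfl⟩ X hX
          obtain ⟨B, hB, rfl⟩ := List.mem_map.1 he
          exact hpart.verts B hB X hX }
    have hH : H.edgeSet = {e | ∃ B ∈ decomposition E BB, e = {x | x ∈ B.1}} := by
      simp [H]
    refine ⟨H, enc (verts E, (decomposition E BB).map fun B => B.1), ?_, ⟨_, _, rfl, rfl, rfl⟩,
      (verts E).finite_toSet, hpart.ri.isAcyclicHypergraph hH, fun h hh => ?_, fun h hh => ?_⟩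
    · rw [treeProjectionOf, if_pos hc]; rfl
    · obtain ⟨e, he, rfl⟩ := mem_edgeSet_hypergraphOf.1 hh
      obtain ⟨B, hB, hsub⟩ := exists_bag_of_isComplete hc he
      exact ⟨{X | X ∈ B.1}, by rw [hH]; exact ⟨B, hB, rfl⟩, hsub⟩
    · rw [hH] at hh
      obtain ⟨B, hB, rfl⟩ := hh
      -- The initial empty bag is also a hyperedge and needs some view to contain it. This is why
      -- `isComplete` also tests that `BB` is non-empty.
      rcases hpart.mem B hB with rfl | hB
      · obtain ⟨B', hB'⟩ := List.exists_mem_of_ne_nil _ (isComplete_iff.1 hc).1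
        obtain ⟨h, hh, -⟩ := hview B' hB'
        exact ⟨h, hh, by simp⟩
      · exact hview B hB
  · right
    refine ⟨by rw [treeProjectionOf, if_neg hc]; rfl, ?_⟩
    rintro ⟨H, hfin, ⟨T, hT, hpath⟩, hQ, hV⟩
    have : Finite H.edgeSet :=
      hfin.finite_subsets.subset fun h hh => H.subset_vertexSet_of_mem_edgeSet' hh
    refine hc (isComplete_of_isTree hT (χ := fun h => h.1)
      (fun i j p hp X hi hj k hk => hpath i j p hp X hi hj k hk) (fun e he => ?_) fun h => ?_)
    · obtain ⟨h, hh, hsub⟩ := hQ _ (mem_edgeSet_hypergraphOf.2 ⟨e, he, rfl⟩)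
      exact ⟨⟨h, hh⟩, fun x hx => hsub hx⟩
    · obtain ⟨h', hh', hsub⟩ := hV h.1 h.2
      obtain ⟨e, he, rfl⟩ := mem_edgeSet_hypergraphOf.1 hh'
      exact ⟨(e, []), List.mem_map.2 ⟨e, he, rfl⟩, fun x hx => hsub hx⟩

instance : Enc treeProjectionProblem.Instance := inferInstanceAs (Enc (ConjQuery × List Atom))

theorem treeProjection_fixedParameterTractable :
    treeProjectionProblem.FixedParameterTractable := by
  refine fixedParameterTractable_of_timeIn (fun _ => rfl) 1 ?_ treeProjection_correct
  have hm : ∀ x : treeProjectionProblem.Instance,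
      sz x ≤ 2 ^ (1 * treeProjectionProblem.param x) * sz x := fun x => sz_le_measure _ _
  have hQ : PolyTime fun x : treeProjectionProblem.Instance => x.1.atoms :=
    PolyTime.cast (f := fun Q : ConjQuery => Q.atoms) (fun _ => rfl) |>.comp PolyTime.fst'
  have hV : PolyTime fun x : treeProjectionProblem.Instance => x.2 := .snd'
  refine PolyTime.treeProjectionOf.comp (TimeIn.pair hm (hQ.edgesOf.timeIn .id hm)
    (TimeIn.subBags hm (K := fun x => 1 * treeProjectionProblem.param x)
      (fun x => two_pow_le_measure _ _) (vs := fun x => viewsOf x.2)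
      (hV.edgesOf.map (.pair (.snd .id) (.const []))) fun x v hv => ?_))
  obtain ⟨e, he, rfl⟩ := List.mem_map.1 hv
  rw [one_mul]
  refine length_le_maxArity (A := x.1.atoms ++ x.2) ?_
  rw [edgesOf, List.map_append]
  exact List.mem_append_right _ he

/-! ### Generalized hypertree decompositions -/

/-- The unions of at most `w` hyperedges, labelled with these hyperedges. -/
def unionsOf (E : List (List ℕ)) : ℕ → List Bag
  | 0 => [([], [])]
  | w + 1 => unionsOf E w ++ (unionsOf E w).flatMap fun v => E.map fun e => (e ++ v.1, e :: v.2)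

theorem of_mem_unionsOf {E : List (List ℕ)} {w : ℕ} {v : Bag} (h : v ∈ unionsOf E w) :
    v.1 = v.2.flatten ∧ (∀ e ∈ v.2, e ∈ E) ∧ v.2.length ≤ w := by
  induction w generalizing v with
  | zero =>
    obtain rfl : v = ([], []) := by simpa [unionsOf] using h
    simp
  | succ w ih =>
    rcases List.mem_append.1 h with h | h
    · obtain ⟨h1, h2, h3⟩ := ih h
      exact ⟨h1, h2, by omega⟩
    · obtain ⟨v', hv', h⟩ := List.mem_flatMap.1 h
      obtain ⟨e, he, rfl⟩ := List.mem_map.1 h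
      obtain ⟨h1, h2, h3⟩ := ih hv'
      refine ⟨by simp [h1], fun e' he' => ?_, by simpa using h3⟩
      rcases List.mem_cons.1 he' with rfl | he'
      · exact he
      · exact h2 e' he'

theorem mem_unionsOf {E lab : List (List ℕ)} {w : ℕ} (h : ∀ e ∈ lab, e ∈ E)
    (hw : lab.length ≤ w) : (lab.flatten, lab) ∈ unionsOf E w := by
  induction w generalizing lab with
  | zero =>
    obtain rfl : lab = [] := List.length_eq_zero_iff.1 (by omega)
    simp [unionsOf]
  | succ w ih =>
    cases lab with
    | nil => exact List.mem_append_left _ (ih (by simp) (by simp))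
    | cons e lab =>
      have hlab : ∀ e' ∈ lab, e' ∈ E := fun e' he' => h e' (by simp [he'])
      refine List.mem_append_right _ (List.mem_flatMap.2 ⟨_, ih hlab (by simpa using hw), ?_⟩)
      exact List.mem_map.2 ⟨e, h e (by simp), by simp⟩

theorem PolyTime.unionsOf {α : Type} [Enc α] {E : α → List (List ℕ)} (hE : PolyTime E) (w : ℕ) :
    PolyTime (fun a => unionsOf (E a) w) := by
  induction w with
  | zero => exact const _
  | succ w ih =>
    exact append ih (flatMap ih (map hE.onFst (pair (append (snd id) (fst (snd (fst id))))
      (cons (snd id) (snd (snd (fst id)))))))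

theorem length_flatten_le {l : List (List ℕ)} {K : ℕ} (h : ∀ e ∈ l, e.length ≤ K) :
    l.flatten.length ≤ l.length * K := by
  rw [List.length_flatten, ← smul_eq_mul, ← List.length_map (as := l)]
  refine List.sum_le_card_nsmul _ _ fun y hy => ?_
  obtain ⟨e, he, rfl⟩ := List.mem_map.1 hy
  exact h e he

/-- The root, the labels and the arcs of a generalized hypertree decomposition, if there is one. -/
def hypertreeOf (E : List (List ℕ)) (BB : List Bag) :
    Option (ℕ × List Bag × List (ℕ × ℕ)) :=
  if isComplete E BB (decomposition E BB) then
    some (0, (decomposition E BB).reverse,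
      (number (decomposition E BB)).map fun e => (e.1, e.2.1))
  else none

theorem PolyTime.hypertreeOf :
    PolyTime (fun x : List (List ℕ) × List Bag => hypertreeOf x.1 x.2) :=
  have h := decomposition (fst (id (α := List (List ℕ) × List Bag))) (snd id)
  ite (isComplete (fst id) (snd id) h)
    (some'.comp (pair (const 0) (pair h.reverse (map h.number
      (pair (fst (snd id)) (fst (snd (snd id)))))))) (const none)

theorem encList_map {α β : Type} {f : α → BTree} {g : β → BTree} {h : α → β}
    (hf : ∀ a, f a = g (h a)) (l : List α) : encList f l = encList g (l.map h) := by
  induction l with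
  | nil => rfl
  | cons a l ih => simp [encList, hf, ih]

theorem encard_setOf_le (l : List (List ℕ)) :
    {h : Set ℕ | ∃ e ∈ l, h = {X | X ∈ e}}.encard ≤ l.length := by
  classical
  have : {h : Set ℕ | ∃ e ∈ l, h = {X | X ∈ e}} =
      (fun e : List ℕ => {X | X ∈ e}) '' (l.toFinset : Set (List ℕ)) := by
    ext h
    simp [eq_comm]
  rw [this]
  refine (Set.encard_image_le _ _).trans ?_
  rw [Set.encard_coe_eq_coe_finsetCard]
  exact_mod_cast l.toFinset_card_le

/-- A decomposition of width at most `w` is a tree decomposition with bags inside unions of at most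
`w` hyperedges; the label that a bag inherits from its union serves as its set of hyperedges. -/
theorem ghd_correct (w : ℕ) (Q : ConjQuery) : (ghdProblem w).CorrectAnswer Q
    (enc (hypertreeOf (edgesOf Q.atoms) (subBags (unionsOf (edgesOf Q.atoms) w)))) := by
  set E := edgesOf Q.atoms with hE
  set BB := subBags (unionsOf E w) with hBB
  by_cases hc : isComplete E BB (decomposition E BB) = true
  · left
    have hpart := isPartial_decomposition E BB
    set L := decomposition E BB with hL
    obtain ⟨par, hp⟩ := hpart.ri.exists_isNumbering
    have hlab : ∀ B ∈ L, (∀ e ∈ B.2, e ∈ E) ∧ B.2.length ≤ w ∧ ∀ x ∈ B.1, x ∈ B.2.flatten := by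
      intro B hB
      rcases hpart.mem B hB with rfl | hB
      · simp
      · obtain ⟨v, hv, h1, h2⟩ := exists_view_of_mem_subBags hB
        obtain ⟨h3, h4, h5⟩ := of_mem_unionsOf hv
        rw [h1, ← h3]
        exact ⟨h4, h5, h2⟩
    have hpar : ∀ i : Fin L.length, par i.1 < L.length := fun i => by
      rcases Nat.eq_zero_or_pos i.1 with h | h
      · rw [h, hp.par_zero]; exact hp.pos
      · exact (hp.par_lt i.1 h i.2).trans i.2
    let labels : Fin L.length → Bag := fun i => L.reverse[i.1]'(by simp)
    have hmem : ∀ i, labels i ∈ L := fun i => List.mem_reverse.1 (List.getElem_mem _)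
    have hbag : ∀ i : Fin L.length, bagAt L i.1 = (labels i).1 := fun i => by
      rw [bagAt, List.getD_eq_getElem _ _ (by simp)]
    -- The order is that of the output of `number`. The arc from `0` to itself is dropped by
    -- `SimpleGraph.fromRel`.
    let arcs : List (Fin L.length × Fin L.length) :=
      ((List.finRange L.length).map fun i => (i, ⟨par i.1, hpar i⟩)).reverse
    have harcs : ∀ p q : Fin L.length, (p, q) ∈ arcs ↔ q.1 = par p.1 := by
      intro p q
      simp only [arcs, List.mem_reverse, List.mem_map, List.mem_finRange, true_and, Prod.mk.injEq,
        Fin.ext_iff]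
      exact ⟨fun ⟨a, h1, h2⟩ => h1 ▸ h2.symm, fun h => ⟨p, rfl, h.symm⟩⟩
    let D : Hypertree :=
      { N := L.length
        T := parentGraph L.length par
        root := ⟨0, hp.pos⟩
        χ := fun i => {X | X ∈ (labels i).1}
        lam := fun i => {h | ∃ e ∈ (labels i).2, h = {X | X ∈ e}} }
    have hχ : ∀ (x : ℕ), ((parentGraph L.length par).induce {p | x ∈ D.χ p}).Preconnected := by
      have h : D.χ = fun p : Fin L.length => {y | y ∈ bagAt L p.1} := by
        funext p
        rw [hbag p]
      rw [h]
      exact hp.preconnected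
    refine ⟨D, enc ((0 : ℕ), L.reverse, (number L).map fun e => (e.1, e.2.1)), ?_,
      ⟨labels, arcs, fun _ => rfl, fun _ => rfl, ?_, ?_⟩, ⟨hp.isTree, fun p x hx => ?_,
      fun p h hh => ?_, fun h hh => ?_, fun x _ => hχ x, fun p x hx => ?_⟩, fun p => ?_⟩
    · rw [hypertreeOf, if_pos hc]; rfl
    · have h : (fun p q : Fin L.length => (p, q) ∈ arcs) = fun p q => q.1 = par p.1 := by
        funext p q
        exact propext (harcs p q)
      rw [h]; rfl
    · have h1 : List.ofFn labels = L.reverse :=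
        List.ext_getElem (by simp) fun i h1 h2 => by simp [labels]
      have h2 : encList (fun a : Fin L.length × Fin L.length =>
          BTree.pair (encNat a.1.1) (encNat a.2.1)) arcs =
          enc ((number L).map fun e => (e.1, e.2.1)) := by
        refine (encList_map (g := (enc : ℕ × ℕ → BTree))
          (h := fun a : Fin L.length × Fin L.length => (a.1.1, a.2.1))
          (fun _ => rfl) arcs).trans ?_
        rw [hp.number_eq]
        refine congrArg (encList enc) ?_
        simp only [arcs, List.map_reverse, List.map_map]
        refine congrArg List.reverse ?_
        rw [← List.map_coe_finRange_eq_range, List.map_map]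
        rfl
      rw [h1, h2]; rfl
    · exact mem_vertexSet_hypergraphOf.2 (hpart.verts _ (hmem p) x hx)
    · obtain ⟨e, he, rfl⟩ := hh
      exact mem_edgeSet_hypergraphOf.2 ⟨e, (hlab _ (hmem p)).1 e he, rfl⟩
    · obtain ⟨e, he, rfl⟩ := mem_edgeSet_hypergraphOf.1 hh
      obtain ⟨B, hB, hsub⟩ := exists_bag_of_isComplete hc he
      obtain ⟨i, hi, h⟩ := exists_bagAt_eq hB
      refine ⟨⟨i, hi⟩, fun x hx => ?_⟩
      have := hsub x hx
      rw [← h, hbag ⟨i, hi⟩] at this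
      exact this
    · obtain ⟨e, he, hxe⟩ := List.mem_flatten.1 ((hlab _ (hmem p)).2.2 x hx)
      exact ⟨_, ⟨e, he, rfl⟩, hxe⟩
    · exact (encard_setOf_le _).trans (by exact_mod_cast (hlab _ (hmem p)).2.1)
  · right
    refine ⟨by rw [hypertreeOf, if_neg hc]; rfl, ?_⟩
    rintro ⟨D, hD, hw⟩
    refine hc (isComplete_of_isTree hD.isTree (χ := D.χ)
      (pathConvex_of_preconnected hD.isTree fun x => ?_) (fun e he => ?_) fun p => ?_)
    · by_cases hx : x ∈ (hypergraphOf Q.atoms).vertexSet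
      · exact hD.connected x hx
      · rintro ⟨p, hp⟩
        exact absurd (hD.χ_subset p hp) hx
    · exact hD.edge_covered _ (mem_edgeSet_hypergraphOf.2 ⟨e, he, rfl⟩)
    · have hfin : (D.lam p).Finite := Set.finite_of_encard_le_coe (hw p)
      choose! rep hrep using fun h (hh : h ∈ D.lam p) =>
        mem_edgeSet_hypergraphOf.1 (hD.lam_subset p hh)
      refine ⟨_, mem_unionsOf (lab := hfin.toFinset.toList.map rep) (fun e he => ?_) ?_,
        fun x hx => ?_⟩
      · obtain ⟨h, hh, rfl⟩ := List.mem_map.1 he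
        exact (hrep h (by simpa using hh)).1
      · rw [List.length_map, Finset.length_toList]
        have := hw p
        rw [hfin.encard_eq_coe_toFinset_card] at this
        exact_mod_cast this
      · obtain ⟨h, hh, hxh⟩ := hD.χ_subset_lam p hx
        refine List.mem_flatten.2 ⟨rep h, List.mem_map.2 ⟨h, by simpa using hh, rfl⟩, ?_⟩
        rw [(hrep h hh).2] at hxh
        exact hxh

instance (w : ℕ) : Enc (ghdProblem w).Instance := inferInstanceAs (Enc ConjQuery)

theorem ghd_fixedParameterTractable (w : ℕ) : (ghdProblem w).FixedParameterTractable := by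
  refine fixedParameterTractable_of_timeIn (fun _ => rfl) w ?_ (ghd_correct w)
  have hm : ∀ x : (ghdProblem w).Instance,
      sz x ≤ 2 ^ (w * (ghdProblem w).param x) * sz x := fun x => sz_le_measure _ _
  have hQ : PolyTime fun x : (ghdProblem w).Instance => edgesOf x.atoms :=
    PolyTime.edgesOf (PolyTime.cast (f := fun Q : ConjQuery => Q.atoms) fun _ => rfl)
  refine PolyTime.hypertreeOf.comp (TimeIn.pair hm (hQ.timeIn .id hm)
    (TimeIn.subBags hm (K := fun x => w * (ghdProblem w).param x)
      (fun x => two_pow_le_measure _ _) (vs := fun x => unionsOf (edgesOf x.atoms) w)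
      (hQ.unionsOf w) fun x v hv => ?_))
  obtain ⟨h1, h2, h3⟩ := of_mem_unionsOf hv
  rw [h1]
  exact (length_flatten_le fun e he => length_le_maxArity (h2 e he)).trans
    (Nat.mul_le_mul_right _ h3)

end TreeProj

theorem mainTheorem12 :
    TreeProj.treeProjectionProblem.FixedParameterTractable ∧
      ∀ w : ℕ, 1 ≤ w → (TreeProj.ghdProblem w).FixedParameterTractable :=
  ⟨TreeProj.treeProjection_fixedParameterTractable,
    fun w _ => TreeProj.ghd_fixedParameterTractable w⟩
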